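/- An initial data set $(M,g,E,B)$ consists of a smooth Riemannian three-manifold $(M,g)$ with boundary and two smooth vector fields $E,B$ on $M$. Here strong asymptotic flatness means that in a chart at infinity $\partial^l(g_{ij}-\delta_{ij})=O(|x|^{-1-l})$ and $\partial^l E^i,\partial^l B^i=O(|x|^{-2-l})$ for $l=0,1,2$, and that the scalar curvature $R_g$ is $O(|x|^{-4})$. Let $m$ denote the ADM mass, and let $q=\sqrt{q_E^2+q_B^2}$ be the total charge, where $q_E=\lim_{R\to\infty}\frac1{4\pi}\int_{S_R}g(E,n)\,dA$ and $q_B=\lim_{R\to\infty}\frac1{4\pi}\int_{S_R}g(B,n)\,dA$. **Theorem.** There is an initial data set $(M,g,E,B)$, with $M=\{x\in\mathbb R^3:|x|\ge a\}$ for some $a>0$, which is invariant under $O(3)$ and has $B=0$, such that: 1. it is strongly asymptotically flat, with ADM mass $m$ and total charge $q$; 2. it satisfies the charged dominant energy condition $R_g\ge 2(|E|_g^2+|B|_g^2)$; 3. its boundary is an outermost minimal surface of area $4\pi\rho^2$, $\rho>0$: $\partial M$ is minimal, and $M$ contains no other closed embedded minimal surface; 4. $|q|\le\rho$ and $|q|\le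 m$; 5. $\operatorname{div}B$ is compactly supported (trivially), but $\operatorname{div}E$ is not; 6. the inequality $\rho\le m+\sqrt{m^2-q^2}$ fails. Moreover, the example can be chosen so that in terms of the area radius $r$, which ranges over $(\rho,\infty)$ in the interior of $M$, $$g=\Bigl(1-\frac{2m(r)}{r}\Bigr)^{-1}dr^2+r^2\,d\omega^2,\qquad E=f(r)\,\partial_r ,$$ where $d\omega^2$ is the round metric on the unit sphere, $m(r)$ is continuous on $[\rho,\infty)$, $m(r)$ and $f(r)$ are smooth for $r>\rho$, $m(\rho)=\rho/2$, $2m(r)<r$ for $r>\rho$, the charged Hawking mass $m(r)+\frac{q^2}{2r}$ is strictly decreasing on $[\rho,\infty)$, and $f(r)^2<\frac{2m'(r)}{r^2}\bigl(1-\frac{2m(r)}{r}\bigr)$ for $r>\rho$. -/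

import Mathlib

open Set Filter Topology MeasureTheory Asymptotics
open scoped ContDiff Matrix

noncomputable section

namespace ChargedData

/-- Euclidean three-space; its coordinates serve as the global chart of the data sets below. -/
abbrev E3 : Type := EuclideanSpace ℝ (Fin 3)

/-- The partial derivative `∂ᵢ f` in the Cartesian coordinates. -/
def pd (i : Fin 3) (f : E3 → ℝ) (x : E3) : ℝ :=
  fderiv ℝ f x (EuclideanSpace.single i 1)

/-! ### Riemannian geometry in the global chart

A metric is given by its components `g x i j`. -/

section Geometry

variable (g : E3 → Matrix (Fin 3) (Fin 3) ℝ)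

/-- The Christoffel symbol `Γᵏᵢⱼ = ½ gᵏˡ (∂ᵢ gⱼₗ + ∂ⱼ gᵢₗ - ∂ₗ gᵢⱼ)`. -/
def christoffel (k i j : Fin 3) (x : E3) : ℝ :=
  (1 / 2) * ∑ l, (g x)⁻¹ k l *
    (pd i (fun y => g y j l) x + pd j (fun y => g y i l) x - pd l (fun y => g y i j) x)

/-- The Ricci tensor
`Ricᵢⱼ = ∂ₖ Γᵏᵢⱼ - ∂ⱼ Γᵏᵢₖ + Γᵏₖₗ Γˡᵢⱼ - Γᵏⱼₗ Γˡᵢₖ`. -/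
def ricci (i j : Fin 3) (x : E3) : ℝ :=
  ∑ k, (pd k (christoffel g k i j) x - pd j (christoffel g k i k) x)
    + ∑ k, ∑ l, (christoffel g k k l x * christoffel g l i j x
        - christoffel g k j l x * christoffel g l i k x)

/-- The scalar curvature `R = gⁱʲ Ricᵢⱼ`. -/
def scalarCurvature (x : E3) : ℝ :=
  ∑ i, ∑ j, (g x)⁻¹ i j * ricci g i j x

/-- The inner product `g(v, w)` of two tangent vectors at `x`. -/
def metricInner (x : E3) (v w : E3) : ℝ :=
  ∑ i, ∑ j, g x i j * v i * w j

/-- The divergence `(det g)^(-1/2) ∂ᵢ ((det g)^(1/2) Vⁱ)` of a vector field. -/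
def divergence (V : E3 → E3) (x : E3) : ℝ :=
  (√(g x).det)⁻¹ * ∑ i, pd i (fun y => √(g y).det * V y i) x

/-- For a covector `α` at `x`, the norm squared `gⁱʲ αᵢ αⱼ`. -/
def covectorNormSq (x : E3) (α : Fin 3 → ℝ) : ℝ :=
  ∑ i, ∑ j, (g x)⁻¹ i j * α i * α j

/-- For a covector `α` at `x`, the `g`-unit vector `gⁱʲ αⱼ / |α|`. -/
def unitDual (x : E3) (α : Fin 3 → ℝ) : E3 :=
  WithLp.toLp 2 fun i => (∑ j, (g x)⁻¹ i j * α j) / √(covectorNormSq g x α)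

/-- The unit normal `∇F / |∇F|` of the level sets of `F`. -/
def levelNormal (F : E3 → ℝ) (x : E3) : E3 :=
  unitDual g x fun i => pd i F x

/-- The mean curvature of the level set of `F` through `x`: the divergence of its unit normal. -/
def meanCurvature (F : E3 → ℝ) (x : E3) : ℝ :=
  divergence g (levelNormal g F) x

/-- `S` is a closed (compact, without boundary) embedded `C²` minimal surface: it is compact and
nonempty, and near each of its points it is a regular level set with vanishing mean curvature. -/
def IsClosedMinimalSurface (S : Set E3) : Prop :=
  IsCompact S ∧ S.Nonempty ∧
    ∀ p ∈ S, ∃ (V : Set E3) (F : E3 → ℝ), IsOpen V ∧ p ∈ V ∧ ContDiffOn ℝ 2 F V ∧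
      (∀ x ∈ V, fderiv ℝ F x ≠ 0) ∧ S ∩ V = {x ∈ V | F x = 0} ∧
      ∀ x ∈ S ∩ V, meanCurvature g F x = 0

/-- The Euclidean outward unit conormal of the coordinate spheres centred at the origin. -/
def radial (x : E3) (i : Fin 3) : ℝ := x i / ‖x‖

/-- The integral of `φ` over the coordinate sphere of radius `R`, with respect to the Euclidean
area. -/
def sphereIntegral (R : ℝ) (φ : E3 → ℝ) : ℝ :=
  R ^ 2 * ∫ u : Metric.sphere (0 : E3) 1, φ (R • (u : E3)) ∂((volume : Measure E3).toSphere)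

/-- The density of the `g`-area of a coordinate sphere with respect to its Euclidean area,
`(det g · gⁱʲ nᵢ nⱼ)^(1/2)` with `n` the Euclidean unit conormal. -/
def areaDensity (x : E3) : ℝ :=
  √((g x).det * covectorNormSq g x (radial x))

/-- The `g`-area of the coordinate sphere of radius `R`. -/
def sphereArea (R : ℝ) : ℝ := sphereIntegral R (areaDensity g)

/-- The charge `(1/4π) ∫ g(V, n) dA` of the field `V` through the coordinate sphere of radius `R`,
where `n` is the outward `g`-unit normal and `dA` the `g`-area. -/
def sphereCharge (V : E3 → E3) (R : ℝ) : ℝ :=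
  (4 * Real.pi)⁻¹ * sphereIntegral R fun x =>
    metricInner g x (V x) (unitDual g x (radial x)) * areaDensity g x

/-- The ADM surface integral `(1/16π) ∫ (∂ⱼ gᵢⱼ - ∂ᵢ gⱼⱼ) nᵢ dσ` over the coordinate sphere of
radius `R`. -/
def admIntegral (R : ℝ) : ℝ :=
  (16 * Real.pi)⁻¹ * sphereIntegral R fun x =>
    ∑ i, ∑ j, (pd j (fun y => g y i j) x - pd i (fun y => g y j j) x) * radial x i

end Geometry

/-- `f = O(|x|⁻ᵖ)`, `∂f = O(|x|⁻ᵖ⁻¹)` and `∂∂f = O(|x|⁻ᵖ⁻²)` at infinity. -/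
def DecaysTwice (p : ℕ) (f : E3 → ℝ) : Prop :=
  (f =O[Bornology.cobounded E3] fun x => (‖x‖ ^ p)⁻¹) ∧
  (∀ k, pd k f =O[Bornology.cobounded E3] fun x => (‖x‖ ^ (p + 1))⁻¹) ∧
  ∀ k l, pd l (pd k f) =O[Bornology.cobounded E3] fun x => (‖x‖ ^ (p + 2))⁻¹

/-- A (time-symmetric) initial data set `(M, g, E, B)` on the exterior `M = {x : a ≤ |x|}` of a
ball in three-space: a Riemannian metric and two vector fields, smooth up to the boundary, that is,
given by functions that are smooth on an open neighbourhood of `M`. The values outside `M` carry no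
information: all derivatives at points of `M` are determined by the values on `M`. -/
structure InitialData where
  /-- The coordinate radius of the boundary sphere. -/
  a : ℝ
  a_pos : 0 < a
  /-- The components of the metric. -/
  g : E3 → Matrix (Fin 3) (Fin 3) ℝ
  /-- The electric field. -/
  E : E3 → E3
  /-- The magnetic field. -/
  B : E3 → E3
  smooth : ∃ U : Set E3, IsOpen U ∧ {x : E3 | a ≤ ‖x‖} ⊆ U ∧
    (∀ i j, ContDiffOn ℝ ∞ (fun x => g x i j) U) ∧ ContDiffOn ℝ ∞ E U ∧ ContDiffOn ℝ ∞ B U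
  posDef : ∀ x : E3, a ≤ ‖x‖ → (g x).PosDef

namespace InitialData

variable (D : InitialData)

/-- The underlying manifold with boundary. -/
def M : Set E3 := {x | D.a ≤ ‖x‖}

/-- The boundary of `M`. -/
def bdry : Set E3 := {x | ‖x‖ = D.a}

/-- Every rotation or reflection of three-space preserves the data. -/
def SphericallySymmetric : Prop :=
  ∀ Q : E3 ≃ₗᵢ[ℝ] E3, ∀ x ∈ D.M,
    (∀ v w, metricInner D.g (Q x) (Q v) (Q w) = metricInner D.g x v w) ∧
    D.E (Q x) = Q (D.E x) ∧ D.B (Q x) = Q (D.B x)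

/-- Strong asymptotic flatness: `∂ˡ(g - δ) = O(|x|⁻¹⁻ˡ)` and `∂ˡE, ∂ˡB = O(|x|⁻²⁻ˡ)` for
`l = 0, 1, 2`, and the scalar curvature is `O(|x|⁻⁴)` (in particular, integrable). -/
def StronglyAsymptoticallyFlat : Prop :=
  (∀ i j, DecaysTwice 1 fun x => D.g x i j - (1 : Matrix (Fin 3) (Fin 3) ℝ) i j) ∧
  (∀ i, DecaysTwice 2 fun x => D.E x i) ∧
  (∀ i, DecaysTwice 2 fun x => D.B x i) ∧
  scalarCurvature D.g =O[Bornology.cobounded E3] fun x => (‖x‖ ^ 4)⁻¹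

/-- The charged dominant energy condition `R ≥ 2 (|E|² + |B|²)`. -/
def ChargedDEC : Prop :=
  ∀ x ∈ D.M, 2 * (metricInner D.g x (D.E x) (D.E x) + metricInner D.g x (D.B x) (D.B x))
    ≤ scalarCurvature D.g x

/-- The boundary is an outermost minimal surface: it is minimal, and `M` contains no other closed
minimal surface. -/
def OutermostMinimalBoundary : Prop :=
  IsClosedMinimalSurface D.g D.bdry ∧
    ∀ S ⊆ D.M, IsClosedMinimalSurface D.g S → S = D.bdry

/-- The ADM mass is `m`. -/
def HasADMMass (m : ℝ) : Prop := Tendsto (admIntegral D.g) atTop (𝓝 m)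

/-- The total charge is `q = (q_E² + q_B²)^(1/2)`, where `q_E` and `q_B` are the total electric and
magnetic charges. -/
def HasTotalCharge (q : ℝ) : Prop :=
  ∃ qE qB : ℝ, Tendsto (sphereCharge D.g D.E) atTop (𝓝 qE) ∧
    Tendsto (sphereCharge D.g D.B) atTop (𝓝 qB) ∧ q = √(qE ^ 2 + qB ^ 2)

/-- The divergence of the field `V` vanishes on `M` outside some compact set. -/
def DivCompactlySupported (V : E3 → E3) : Prop :=
  ∃ K : Set E3, IsCompact K ∧ ∀ x ∈ D.M, x ∉ K → divergence D.g V x = 0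

/-- In terms of the area radius `r = σ(|x|)`, which maps the interior of `M` diffeomorphically to
`r > r₀`, one has `g = (1 - 2 μ(r) / r)⁻¹ dr² + r² dω²` and `E = f(r) ∂ᵣ` there. -/
def ArealForm (r₀ : ℝ) (μ f : ℝ → ℝ) : Prop :=
  ∃ σ : ℝ → ℝ, σ D.a = r₀ ∧ ContinuousOn σ (Ici D.a) ∧ ContDiffOn ℝ ∞ σ (Ioi D.a) ∧
    (∀ R > D.a, 0 < deriv σ R) ∧ Tendsto σ atTop atTop ∧
    ∀ x : E3, D.a < ‖x‖ →
      (∀ i j, D.g x i j =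
        (1 - 2 * μ (σ ‖x‖) / σ ‖x‖)⁻¹ * (deriv σ ‖x‖ * radial x i) * (deriv σ ‖x‖ * radial x j)
          + σ ‖x‖ ^ 2 * (((1 : Matrix (Fin 3) (Fin 3) ℝ) i j - radial x i * radial x j)
              / ‖x‖ ^ 2)) ∧
      ∀ i, D.E x i = f (σ ‖x‖) / deriv σ ‖x‖ * radial x i

end InitialData

end ChargedData

end

noncomputable section

namespace ChargedData

/-! For a rotationally symmetric metric with area radius r and mass function m(r), the scalar
curvature is 4m'/r². If Q(r) is the charge inside the sphere of area radius r, then |E|² = Q²/r⁴, so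
the energy condition reads m' ≥ Q²/(2r²). When no charge lies outside the horizon, Q = q and m(r) +
q²/(2r) cannot decrease; comparing r = ρ with infinity gives ρ/2 + q²/(2ρ) ≤ m, hence the Penrose
inequality. When charge of one sign is spread over the whole exterior, Q(r) < q, there is room for
m' < q²/(2r²), and the charged Hawking mass may decrease.

The example has ρ = 4, q = 2, m(r) = 9/4 - 2/r + 4/r² and f(r) = (2/r²)(1 - 4/r)². Its charged
Hawking mass 9/4 + 4/r² falls from 5/2 to 9/4, and 9/4 + √17/4 < 4. Since 1 - 2m/r = (1 - 4/r)(1 -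
1/(2r) + 2/r²), the energy condition reduces to (1 - 4/r)² ≤ 1 - 1/(2r) + 2/r². The enclosed charge
stays below 2 and tends to 2, so `div E` cannot have compact support.

Smoothness up to the boundary comes from the coordinate R with r = (R + 1)²/R: as r - 4 = (R -
1)²/R, the double zero of 1 - 2m/r at R = 1 cancels against (dr/dR)². Curvatures come from
`scalarCurvature_radialMetric`, applied to a metric α δ + β x⊗x.

The boundary is outermost by comparison with spheres (`eq_sphere_of_isClosedMinimalSurface`). At a
point farthest from the origin, a closed surface is tangent to a sphere and curves at least as much
(`trace_hessian_of_nonneg_exterior`). Spheres with R > 1 have positive mean curvature, so a minimal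
surface cannot reach beyond R = 1 (`meanCurvature_of_tangent`). -/

/-- The Kronecker symbol. -/
def kron (i j : Fin 3) : ℝ := if i = j then 1 else 0

theorem kron_comm (i j : Fin 3) : kron i j = kron j i := by
  simp only [kron, eq_comm]

/-! ### Calculus of functions of the distance to the origin -/

theorem norm_sq_eq_sum (x : E3) : ‖x‖ ^ 2 = x 0 ^ 2 + x 1 ^ 2 + x 2 ^ 2 := by
  rw [EuclideanSpace.real_norm_sq_eq, Fin.sum_univ_three]

theorem hasFDerivAt_comp_norm {φ : ℝ → ℝ} {φ' : ℝ} {x : E3} (hx : x ≠ 0)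
    (h : HasDerivAt φ φ' ‖x‖) :
    HasFDerivAt (fun y : E3 => φ ‖y‖) ((φ' / ‖x‖) • innerSL ℝ x) x := by
  have hn : ‖x‖ ≠ 0 := norm_ne_zero_iff.2 hx
  have h1 : HasFDerivAt (fun y : E3 => ‖y‖) ((1 / ‖x‖) • innerSL ℝ x) x := by
    have h2 : HasFDerivAt (fun y : E3 => √(‖y‖ ^ 2)) _ x :=
      (hasStrictFDerivAt_norm_sq x).hasFDerivAt.sqrt (by positivity)
    simp only [Real.sqrt_sq (norm_nonneg _)] at h2
    rw [← Nat.cast_smul_eq_nsmul ℝ, smul_smul,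
      show 1 / (2 * ‖x‖) * ((2 : ℕ) : ℝ) = 1 / ‖x‖ by push_cast; field_simp] at h2
    exact h2
  have h3 := h.comp_hasFDerivAt x h1
  rw [smul_smul, mul_one_div] at h3
  exact h3

theorem hasFDerivAt_coord (i : Fin 3) (x : E3) :
    HasFDerivAt (fun y : E3 => y i) (EuclideanSpace.proj i : E3 →L[ℝ] ℝ) x :=
  (EuclideanSpace.proj i : E3 →L[ℝ] ℝ).hasFDerivAt

@[fun_prop]
theorem differentiableAt_coord (i : Fin 3) (x : E3) : DifferentiableAt ℝ (fun y : E3 => y i) x :=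
  (hasFDerivAt_coord i x).differentiableAt

theorem pd_coord (k i : Fin 3) (x : E3) :
    pd k (fun y => y i) x = kron i k := by
  rw [pd, (hasFDerivAt_coord i x).fderiv]
  simp [kron]

theorem pd_const (k : Fin 3) (c : ℝ) (x : E3) : pd k (fun _ => c) x = 0 := by
  simp [pd]

theorem pd_add {f h : E3 → ℝ} {x : E3} (k : Fin 3) (hf : DifferentiableAt ℝ f x)
    (hh : DifferentiableAt ℝ h x) : pd k (fun y => f y + h y) x = pd k f x + pd k h x := by
  simp only [pd]
  rw [fderiv_fun_add hf hh]; rfl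

theorem pd_mul {f h : E3 → ℝ} {x : E3} (k : Fin 3) (hf : DifferentiableAt ℝ f x)
    (hh : DifferentiableAt ℝ h x) :
    pd k (fun y => f y * h y) x = pd k f x * h x + f x * pd k h x := by
  simp only [pd]
  rw [fderiv_fun_mul hf hh]
  simp; ring

theorem pd_inv {f : E3 → ℝ} {x : E3} (k : Fin 3) (hf : DifferentiableAt ℝ f x) (h0 : f x ≠ 0) :
    pd k (fun y => (f y)⁻¹) x = -(pd k f x * ((f x)⁻¹ * (f x)⁻¹)) := by
  have h1 := (hasDerivAt_inv h0).comp_hasFDerivAt x hf.hasFDerivAt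
  simp only [pd]
  rw [show (fun y => (f y)⁻¹) = Inv.inv ∘ f from rfl, h1.fderiv]
  simp
  field_simp

theorem pd_sum {ι : Type*} (s : Finset ι) {f : ι → E3 → ℝ} {x : E3} (k : Fin 3)
    (hf : ∀ j ∈ s, DifferentiableAt ℝ (f j) x) :
    pd k (fun y => ∑ j ∈ s, f j y) x = ∑ j ∈ s, pd k (f j) x := by
  simp only [pd]
  rw [fderiv_fun_sum hf]
  simp

theorem pd_congr {f h : E3 → ℝ} {x : E3} (k : Fin 3) (hfh : f =ᶠ[𝓝 x] h) :
    pd k f x = pd k h x := by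
  simp only [pd, hfh.fderiv_eq]

theorem pd_comp_norm {φ : ℝ → ℝ} {φ' : ℝ} {x : E3} (hx : x ≠ 0) (h : HasDerivAt φ φ' ‖x‖)
    (k : Fin 3) : pd k (fun y => φ ‖y‖) x = φ' / ‖x‖ * x k := by
  rw [pd, (hasFDerivAt_comp_norm hx h).fderiv]
  simp [EuclideanSpace.inner_single_right]

theorem differentiableAt_comp_norm {φ : ℝ → ℝ} {x : E3} (hx : x ≠ 0)
    (h : DifferentiableAt ℝ φ ‖x‖) : DifferentiableAt ℝ (fun y : E3 => φ ‖y‖) x :=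
  (hasFDerivAt_comp_norm hx h.hasDerivAt).differentiableAt

theorem pd_comp_norm_mul {φ : ℝ → ℝ} {φ' : ℝ} {h : E3 → ℝ} {x : E3} (hx : x ≠ 0)
    (hφ : HasDerivAt φ φ' ‖x‖) (k : Fin 3) (hh : DifferentiableAt ℝ h x) :
    pd k (fun y => φ ‖y‖ * h y) x = φ' / ‖x‖ * x k * h x + φ ‖x‖ * pd k h x := by
  rw [pd_mul k (differentiableAt_comp_norm hx hφ.differentiableAt) hh, pd_comp_norm hx hφ]

/-! ### Rotationally symmetric metrics -/

/-- The metric `α(|x|) δᵢⱼ + β(|x|) xᵢ xⱼ`. -/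
def radialMetric (α β : ℝ → ℝ) (x : E3) : Matrix (Fin 3) (Fin 3) ℝ :=
  fun i j => α ‖x‖ * kron i j + β ‖x‖ * (x i * x j)

/-- The squared length of the Euclidean unit radial vector in the metric `radialMetric α β`. -/
def radialCoeff (α β : ℝ → ℝ) (R : ℝ) : ℝ := α R + β R * R ^ 2

section RadialMetric

variable {α β : ℝ → ℝ} {x : E3}

/-- The Sherman–Morrison formula: the metric is a multiple of the identity plus a rank-one term. -/
theorem radialMetric_inv (hα : α ‖x‖ ≠ 0) (hγ : radialCoeff α β ‖x‖ ≠ 0) :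
    (radialMetric α β x)⁻¹ = Matrix.of fun i j => (α ‖x‖)⁻¹ * kron i j
      - β ‖x‖ / (α ‖x‖ * radialCoeff α β ‖x‖) * (x i * x j) := by
  apply Matrix.inv_eq_right_inv
  ext i j
  have h := norm_sq_eq_sum x
  unfold radialCoeff at *
  simp only [Matrix.mul_apply, radialMetric, Fin.sum_univ_three, Matrix.one_apply, kron,
    Matrix.of_apply]
  generalize α ‖x‖ = a at *
  generalize β ‖x‖ = b at *
  rw [h] at *
  fin_cases i <;> fin_cases j <;> simp <;> field_simp <;> ring

theorem radialMetric_det :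
    (radialMetric α β x).det = α ‖x‖ ^ 2 * radialCoeff α β ‖x‖ := by
  rw [Matrix.det_fin_three, radialCoeff, norm_sq_eq_sum x]
  simp [radialMetric, kron]
  ring

theorem metricInner_radialMetric (v w : E3) :
    metricInner (radialMetric α β) x v w
      = α ‖x‖ * inner ℝ v w + β ‖x‖ * (inner ℝ x v * inner ℝ x w) := by
  simp only [metricInner, radialMetric, Fin.sum_univ_three, kron, PiLp.inner_apply]
  simp
  ring

theorem radialMetric_posDef (hα : 0 < α ‖x‖) (hγ : 0 < radialCoeff α β ‖x‖) :
    (radialMetric α β x).PosDef := by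
  refine Matrix.PosDef.of_dotProduct_mulVec_pos ?_ ?_
  · ext i j
    simp [radialMetric, kron, eq_comm, mul_comm]
  · intro v hv
    have h := norm_sq_eq_sum x
    have hv2 : 0 < v 0 ^ 2 + v 1 ^ 2 + v 2 ^ 2 := by
      by_contra! hle
      apply hv
      ext i
      fin_cases i <;> simp <;>
        nlinarith [sq_nonneg (v 0), sq_nonneg (v 1), sq_nonneg (v 2)]
    have hcs : (x 0 * v 0 + x 1 * v 1 + x 2 * v 2) ^ 2 ≤ ‖x‖ ^ 2 * (v 0 ^ 2 + v 1 ^ 2 + v 2 ^ 2) := by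
      rw [h]
      nlinarith [sq_nonneg (x 0 * v 1 - x 1 * v 0), sq_nonneg (x 0 * v 2 - x 2 * v 0),
        sq_nonneg (x 1 * v 2 - x 2 * v 1)]
    have key : star v ⬝ᵥ radialMetric α β x *ᵥ v = α ‖x‖ * (v 0 ^ 2 + v 1 ^ 2 + v 2 ^ 2)
        + β ‖x‖ * (x 0 * v 0 + x 1 * v 1 + x 2 * v 2) ^ 2 := by
      simp [dotProduct, Matrix.mulVec, radialMetric, Fin.sum_univ_three, kron]
      ring
    rw [key]
    unfold radialCoeff at hγ
    rcases le_or_gt 0 (β ‖x‖) with hβ | hβ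
    -- For `β < 0`, Cauchy–Schwarz reduces the bound to the radial direction, where the coefficient
    -- is `radialCoeff`.
    · positivity
    · nlinarith [mul_le_mul_of_nonpos_left hcs hβ.le, mul_pos hγ hv2]

theorem covectorNormSq_radialMetric (hα : α ‖x‖ ≠ 0) (hγ : radialCoeff α β ‖x‖ ≠ 0)
    (ξ : Fin 3 → ℝ) :
    covectorNormSq (radialMetric α β) x ξ = (α ‖x‖)⁻¹ * ∑ i, ξ i ^ 2
      - β ‖x‖ / (α ‖x‖ * radialCoeff α β ‖x‖) * (∑ i, x i * ξ i) ^ 2 := by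
  rw [covectorNormSq, radialMetric_inv hα hγ]
  simp only [Fin.sum_univ_three, Matrix.of_apply, kron]
  simp
  ring

theorem sum_radialMetric_inv_mul (hα : α ‖x‖ ≠ 0) (hγ : radialCoeff α β ‖x‖ ≠ 0)
    (ξ : Fin 3 → ℝ) (i : Fin 3) :
    ∑ j, (radialMetric α β x)⁻¹ i j * ξ j = (α ‖x‖)⁻¹ * ξ i
      - β ‖x‖ / (α ‖x‖ * radialCoeff α β ‖x‖) * (x i * ∑ j, x j * ξ j) := by
  rw [radialMetric_inv hα hγ]
  simp only [Fin.sum_univ_three, Matrix.of_apply, kron]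
  fin_cases i <;> simp <;> ring

theorem pd_radialMetric {α' β' : ℝ} (hx : x ≠ 0) (hα : HasDerivAt α α' ‖x‖)
    (hβ : HasDerivAt β β' ‖x‖) (k i j : Fin 3) :
    pd k (fun y => radialMetric α β y i j) x
      = α' / ‖x‖ * x k * kron i j + β' / ‖x‖ * x k * (x i * x j)
        + β ‖x‖ * (kron i k * x j
          + x i * kron j k) := by
  have h1 : DifferentiableAt ℝ (fun y : E3 => y i * y j) x := by fun_prop
  simp only [radialMetric]
  rw [pd_add k
    (.fun_mul (differentiableAt_comp_norm hx hα.differentiableAt) (differentiableAt_const _))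
    (.fun_mul (differentiableAt_comp_norm hx hβ.differentiableAt) h1),
    pd_comp_norm_mul hx hα k (differentiableAt_const _), pd_comp_norm_mul hx hβ k h1, pd_const,
    pd_mul k (differentiableAt_coord i x) (differentiableAt_coord j x), pd_coord, pd_coord]
  ring

/-- The general form of the Christoffel symbols of a rotationally symmetric metric. -/
def radialConnection (P Q S : ℝ → ℝ) (k i j : Fin 3) (x : E3) : ℝ :=
  P ‖x‖ * (x i * kron j k + x j * kron i k)
    + Q ‖x‖ * (x k * kron i j) + S ‖x‖ * (x i * x j * x k)

/-- The relations for `P`, `Q`, `S` carry no division, so that closed rational expressions for them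
can be checked by clearing denominators. -/
theorem christoffel_radialMetric {α' β' : ℝ} {P Q S : ℝ → ℝ} (hx : x ≠ 0)
    (hα : HasDerivAt α α' ‖x‖) (hβ : HasDerivAt β β' ‖x‖) (hα0 : α ‖x‖ ≠ 0)
    (hγ : radialCoeff α β ‖x‖ ≠ 0) (hP : 2 * ‖x‖ * α ‖x‖ * P ‖x‖ = α')
    (hQ : 2 * ‖x‖ * radialCoeff α β ‖x‖ * Q ‖x‖ = 2 * ‖x‖ * β ‖x‖ - α')
    (hS : 2 * ‖x‖ * α ‖x‖ * radialCoeff α β ‖x‖ * S ‖x‖ = β' * α ‖x‖ - 2 * α' * β ‖x‖)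
    (k i j : Fin 3) :
    christoffel (radialMetric α β) k i j x = radialConnection P Q S k i j x := by
  have hn : ‖x‖ ≠ 0 := norm_ne_zero_iff.2 hx
  have h := norm_sq_eq_sum x
  have hβ' : β' = (2 * ‖x‖ * α ‖x‖ * radialCoeff α β ‖x‖ * S ‖x‖ + 2 * α' * β ‖x‖) / α ‖x‖ := by
    field_simp; linarith
  have hβ0 : β ‖x‖ = radialCoeff α β ‖x‖ * Q ‖x‖ + α ‖x‖ * P ‖x‖ := by
    apply mul_left_cancel₀ (mul_ne_zero two_ne_zero hn)
    linear_combination -hQ - hP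
  rw [christoffel, sum_radialMetric_inv_mul hα0 hγ]
  simp only [pd_radialMetric hx hα hβ]
  have hsum : ∑ l, x l * (α' / ‖x‖ * x i * kron j l + β' / ‖x‖ * x i * (x j * x l)
        + β ‖x‖ * (kron j i * x l + x j * kron l i)
      + (α' / ‖x‖ * x j * kron i l + β' / ‖x‖ * x j * (x i * x l)
        + β ‖x‖ * (kron i j * x l + x i * kron l j))
      - (α' / ‖x‖ * x l * kron i j + β' / ‖x‖ * x l * (x i * x j)
        + β ‖x‖ * (kron i l * x j + x i * kron j l)))
      = α' / ‖x‖ * (2 * (x i * x j) - ‖x‖ ^ 2 * kron i j)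
        + β' / ‖x‖ * ‖x‖ ^ 2 * (x i * x j) + 2 * β ‖x‖ * ‖x‖ ^ 2 * kron i j := by
    generalize α' / ‖x‖ = a
    generalize β' / ‖x‖ = b
    generalize β ‖x‖ = c
    rw [h, Fin.sum_univ_three]
    fin_cases i <;> fin_cases j <;> simp [kron] <;> ring
  rw [hsum, hβ', hβ0, ← hP, kron_comm j i, kron_comm k i, kron_comm k j, radialConnection]
  -- With `β` and `β'` eliminated in favour of `P`, `Q`, `S`, the definition of `radialCoeff` is the
  -- one relation left between the remaining quantities.
  have hγ' : radialCoeff α β ‖x‖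
      = α ‖x‖ + (radialCoeff α β ‖x‖ * Q ‖x‖ + α ‖x‖ * P ‖x‖) * ‖x‖ ^ 2 := by
    rw [← hβ0, radialCoeff]
  generalize radialCoeff α β ‖x‖ = γ at *
  field_simp
  linear_combination (2 * γ * Q ‖x‖ * x k * kron i j
    + x i * x j * x k * (2 * γ * S ‖x‖ + 4 * P ‖x‖ * Q ‖x‖ * γ + 4 * P ‖x‖ ^ 2 * α ‖x‖)) * hγ'

/-- `S'` drops out: ∂ₖ(S xᵢxⱼxₖ) and ∂ⱼ(S xᵢ|x|²) contribute the same multiple of it. The symbols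
are needed on a neighbourhood because they are differentiated. -/
theorem ricci_radialConnection {g : E3 → Matrix (Fin 3) (Fin 3) ℝ} {P Q S : ℝ → ℝ} {P' Q' S' : ℝ}
    (hx : x ≠ 0) (hΓ : ∀ k i j, christoffel g k i j =ᶠ[𝓝 x] radialConnection P Q S k i j)
    (hP : HasDerivAt P P' ‖x‖) (hQ : HasDerivAt Q Q' ‖x‖) (hS : HasDerivAt S S' ‖x‖)
    (i j : Fin 3) :
    ricci g i j x =
      (-2 * P ‖x‖ + 2 * Q ‖x‖ - S ‖x‖ * ‖x‖ ^ 2 + Q' * ‖x‖ + 2 * P ‖x‖ * Q ‖x‖ * ‖x‖ ^ 2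
          + Q ‖x‖ ^ 2 * ‖x‖ ^ 2 + Q ‖x‖ * S ‖x‖ * ‖x‖ ^ 4) * kron i j
        + (-2 * P' / ‖x‖ - Q' / ‖x‖ + 3 * S ‖x‖ + 2 * P ‖x‖ ^ 2 + 2 * P ‖x‖ * S ‖x‖ * ‖x‖ ^ 2
          - Q ‖x‖ ^ 2 - Q ‖x‖ * S ‖x‖ * ‖x‖ ^ 2) * (x i * x j) := by
  have hn : ‖x‖ ≠ 0 := norm_ne_zero_iff.2 hx
  have hpd : ∀ l k i j, pd l (christoffel g k i j) x =
      P' / ‖x‖ * x l * (x i * kron j k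
          + x j * kron i k)
        + P ‖x‖ * (kron i l * kron j k
          + kron j l * kron i k)
        + Q' / ‖x‖ * x l * (x k * kron i j)
        + Q ‖x‖ * (kron k l * kron i j)
        + S' / ‖x‖ * x l * (x i * x j * x k)
        + S ‖x‖ * (kron i l * x j * x k
          + x i * kron j l * x k
          + x i * x j * kron k l) := by
    intro l k i j
    rw [pd_congr l (hΓ k i j)]
    unfold radialConnection
    have dP := differentiableAt_comp_norm hx hP.differentiableAt
    have dQ := differentiableAt_comp_norm hx hQ.differentiableAt
    have dS := differentiableAt_comp_norm hx hS.differentiableAt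
    rw [pd_add l (.fun_add (.fun_mul dP (by fun_prop)) (.fun_mul dQ (by fun_prop)))
        (.fun_mul dS (by fun_prop)),
      pd_add l (.fun_mul dP (by fun_prop)) (.fun_mul dQ (by fun_prop)),
      pd_comp_norm_mul hx hP l (by fun_prop), pd_comp_norm_mul hx hQ l (by fun_prop),
      pd_comp_norm_mul hx hS l (by fun_prop), pd_add l (by fun_prop) (by fun_prop),
      pd_mul l (by fun_prop) (by fun_prop), pd_mul l (by fun_prop) (by fun_prop),
      pd_mul l (by fun_prop) (by fun_prop), pd_mul l (by fun_prop) (by fun_prop),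
      pd_mul l (by fun_prop) (by fun_prop)]
    simp only [pd_coord, pd_const]
    ring
  have hΓx : ∀ k i j, christoffel g k i j x = radialConnection P Q S k i j x :=
    fun k i j => (hΓ k i j).self_of_nhds
  simp only [ricci, hpd, hΓx]
  unfold radialConnection
  have e1 : Q' * ‖x‖ = Q' / ‖x‖ * ‖x‖ ^ 2 := by field_simp
  have e2 : -2 * P' / ‖x‖ = -2 * (P' / ‖x‖) := by ring
  rw [e1, e2, show ‖x‖ ^ 4 = (‖x‖ ^ 2) ^ 2 by ring, norm_sq_eq_sum x]
  clear hpd hΓ hΓx e1 e2 hP hQ hS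
  generalize P' / ‖x‖ = p
  generalize Q' / ‖x‖ = q
  generalize S' / ‖x‖ = s
  generalize P ‖x‖ = P0
  generalize Q ‖x‖ = Q0
  generalize S ‖x‖ = S0
  simp only [Fin.sum_univ_three]
  fin_cases i <;> fin_cases j <;> simp [kron] <;> ring

end RadialMetric

/-- With Ric = U δ + W x⊗x, the two tangential directions contribute 2U/α and the radial one (U +
W|x|²)/γ, where γ is `radialCoeff`. -/
theorem scalarCurvature_radialMetric {α β P Q S : ℝ → ℝ} {P' Q' S' : ℝ} {x : E3} (hx : x ≠ 0)
    (hα : α ‖x‖ ≠ 0) (hγ : radialCoeff α β ‖x‖ ≠ 0)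
    (hΓ : ∀ k i j,
      christoffel (radialMetric α β) k i j =ᶠ[𝓝 x] radialConnection P Q S k i j)
    (hP : HasDerivAt P P' ‖x‖) (hQ : HasDerivAt Q Q' ‖x‖) (hS : HasDerivAt S S' ‖x‖) :
    scalarCurvature (radialMetric α β) x =
      (2 / α ‖x‖ + 1 / radialCoeff α β ‖x‖) *
        (-2 * P ‖x‖ + 2 * Q ‖x‖ - S ‖x‖ * ‖x‖ ^ 2 + Q' * ‖x‖ + 2 * P ‖x‖ * Q ‖x‖ * ‖x‖ ^ 2
          + Q ‖x‖ ^ 2 * ‖x‖ ^ 2 + Q ‖x‖ * S ‖x‖ * ‖x‖ ^ 4)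
      + ‖x‖ ^ 2 / radialCoeff α β ‖x‖ *
        (-2 * P' / ‖x‖ - Q' / ‖x‖ + 3 * S ‖x‖ + 2 * P ‖x‖ ^ 2 + 2 * P ‖x‖ * S ‖x‖ * ‖x‖ ^ 2
          - Q ‖x‖ ^ 2 - Q ‖x‖ * S ‖x‖ * ‖x‖ ^ 2) := by
  rw [scalarCurvature, radialMetric_inv hα hγ]
  simp only [ricci_radialConnection hx hΓ hP hQ hS]
  generalize -2 * P ‖x‖ + 2 * Q ‖x‖ - S ‖x‖ * ‖x‖ ^ 2 + Q' * ‖x‖ + 2 * P ‖x‖ * Q ‖x‖ * ‖x‖ ^ 2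
          + Q ‖x‖ ^ 2 * ‖x‖ ^ 2 + Q ‖x‖ * S ‖x‖ * ‖x‖ ^ 4 = U
  generalize -2 * P' / ‖x‖ - Q' / ‖x‖ + 3 * S ‖x‖ + 2 * P ‖x‖ ^ 2
          + 2 * P ‖x‖ * S ‖x‖ * ‖x‖ ^ 2 - Q ‖x‖ ^ 2 - Q ‖x‖ * S ‖x‖ * ‖x‖ ^ 2 = W
  have hB : radialCoeff α β ‖x‖ = α ‖x‖ + β ‖x‖ * ‖x‖ ^ 2 := rfl
  have e : ∑ i, ∑ j, (Matrix.of fun i j => (α ‖x‖)⁻¹ * kron i j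
        - β ‖x‖ / (α ‖x‖ * radialCoeff α β ‖x‖) * (x i * x j)) i j * (U * kron i j + W * (x i * x j))
      = (α ‖x‖)⁻¹ * (3 * U + W * ‖x‖ ^ 2) - β ‖x‖ / (α ‖x‖ * radialCoeff α β ‖x‖) *
        (U * ‖x‖ ^ 2 + W * (‖x‖ ^ 2) ^ 2) := by
    rw [norm_sq_eq_sum x]
    simp [Fin.sum_univ_three, kron]
    ring
  rw [e]
  generalize radialCoeff α β ‖x‖ = γ at *
  field_simp
  linear_combination (W * ‖x‖ ^ 2 + U) * hB

/-! ### The metric of the example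

With `r = (R + 1)² / R` the area radius, it is
`(1 - 1 / (2 r) + 2 / r²)⁻¹ (r / R)² dR² + r² dω²`. -/

/-- The denominator `2 R² (r² - r / 2 + 2)` of the coefficients, for `r = (R + 1)² / R`. -/
def quartic (R : ℝ) : ℝ := 2 * R ^ 4 + 7 * R ^ 3 + 14 * R ^ 2 + 7 * R + 2

/-- The tangential coefficient of the metric. -/
def coeffα (R : ℝ) : ℝ := (R + 1) ^ 4 / R ^ 4

/-- The coefficient of `xᵢ xⱼ` in the metric. -/
def coeffβ (R : ℝ) : ℝ := (R + 1) ^ 4 * (R - 1) ^ 2 / (R ^ 5 * quartic R)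

/-- The metric of the example. -/
def exampleMetric : E3 → Matrix (Fin 3) (Fin 3) ℝ := radialMetric coeffα coeffβ

theorem quartic_pos {R : ℝ} (hR : 0 < R) : 0 < quartic R := by
  unfold quartic; positivity

theorem hasDerivAt_quartic (R : ℝ) :
    HasDerivAt quartic (8 * R ^ 3 + 21 * R ^ 2 + 28 * R + 7) R := by
  have h := ((((hasDerivAt_pow 4 R).const_mul 2).add ((hasDerivAt_pow 3 R).const_mul 7)).add
    ((hasDerivAt_pow 2 R).const_mul 14)).add (((hasDerivAt_id R).const_mul 7).add_const 2)
  refine (h.congr_deriv ?_).congr_of_eventuallyEq (.of_forall fun y => ?_)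
  · norm_num; ring
  · simp [quartic]; ring

theorem coeffα_pos {R : ℝ} (hR : 0 < R) : 0 < coeffα R := by
  unfold coeffα; positivity

/-- This is (dr/dR)²/(1 - 2m/r). The factors (R - 1)² have cancelled, which makes the metric regular
at the horizon R = 1. -/
theorem radialCoeff_example {R : ℝ} (hR : 0 < R) :
    radialCoeff coeffα coeffβ R = 2 * (R + 1) ^ 8 / (R ^ 4 * quartic R) := by
  have h := quartic_pos hR
  unfold radialCoeff coeffα coeffβ
  field_simp
  unfold quartic
  ring

theorem radialCoeff_example_pos {R : ℝ} (hR : 0 < R) : 0 < radialCoeff coeffα coeffβ R := by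
  have h := quartic_pos hR
  rw [radialCoeff_example hR]; positivity

theorem hasDerivAt_coeffα {R : ℝ} (hR : 0 < R) :
    HasDerivAt coeffα (-4 * (R + 1) ^ 3 / R ^ 5) R := by
  have h := (((hasDerivAt_id R).add_const 1).pow 4).div (hasDerivAt_pow 4 R) (by positivity)
  refine h.congr_deriv ?_
  simp only [id, Pi.pow_apply]
  field_simp
  push_cast
  ring

/-- The derivative of `coeffβ`. -/
def coeffβ' (R : ℝ) : ℝ :=
  ((4 * (R + 1) ^ 3 * (R - 1) ^ 2 + 2 * (R + 1) ^ 4 * (R - 1)) * (R * quartic R)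
    - (R + 1) ^ 4 * (R - 1) ^ 2 *
      (5 * quartic R + R * (8 * R ^ 3 + 21 * R ^ 2 + 28 * R + 7))) / (R ^ 6 * quartic R ^ 2)

theorem hasDerivAt_coeffβ {R : ℝ} (hR : 0 < R) : HasDerivAt coeffβ (coeffβ' R) R := by
  have hq := quartic_pos hR
  have h := ((((hasDerivAt_id R).add_const 1).pow 4).mul
    (((hasDerivAt_id R).sub_const 1).pow 2)).div
      ((hasDerivAt_pow 5 R).mul (hasDerivAt_quartic R)) (by simp only [Pi.mul_apply]; positivity)
  refine h.congr_deriv ?_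
  simp only [id, Pi.pow_apply, Pi.mul_apply, coeffβ']
  field_simp
  push_cast
  ring

/-- The coefficient of `xᵢ δⱼₖ + xⱼ δᵢₖ` in the Christoffel symbols. -/
def coeffP (R : ℝ) : ℝ := -2 / (R ^ 2 * (R + 1))

/-- The coefficient of `xₖ δᵢⱼ` in the Christoffel symbols. -/
def coeffQ (R : ℝ) : ℝ :=
  (R * (R - 1) ^ 2 * (R + 1) + 2 * quartic R) / (2 * R ^ 2 * (R + 1) ^ 5)

/-- The coefficient of `xᵢ xⱼ xₖ` in the Christoffel symbols. -/
def coeffS (R : ℝ) : ℝ :=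
  (R - 1) * ((R + 1) * ((R + 1) * quartic R
      - (R - 1) * R * (8 * R ^ 3 + 21 * R ^ 2 + 28 * R + 7)) + 4 * (R - 1) * quartic R)
    / (4 * R ^ 3 * (R + 1) ^ 5 * quartic R)

theorem christoffel_example {x : E3} (hx : x ≠ 0) (k i j : Fin 3) :
    christoffel exampleMetric k i j x = radialConnection coeffP coeffQ coeffS k i j x := by
  have hn : 0 < ‖x‖ := norm_pos_iff.2 hx
  have hq := quartic_pos hn
  refine christoffel_radialMetric hx (hasDerivAt_coeffα hn) (hasDerivAt_coeffβ hn)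
    (coeffα_pos hn).ne' (radialCoeff_example_pos hn).ne' ?_ ?_ ?_ k i j
  · unfold coeffα coeffP; field_simp; ring
  · rw [radialCoeff_example hn]; unfold coeffβ coeffQ; field_simp; ring
  · rw [radialCoeff_example hn]; unfold coeffα coeffβ coeffβ' coeffS; field_simp; ring

theorem hasDerivAt_coeffP {R : ℝ} (hR : 0 < R) :
    HasDerivAt coeffP (2 * (3 * R + 2) / (R ^ 3 * (R + 1) ^ 2)) R := by
  have h := (hasDerivAt_const R (-2 : ℝ)).div
    ((hasDerivAt_pow 2 R).mul ((hasDerivAt_id R).add_const 1))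
      (by simp only [id, Pi.mul_apply]; positivity)
  refine h.congr_deriv ?_
  simp only [id, Pi.mul_apply]
  field_simp
  push_cast
  ring

/-- The derivative of `coeffQ`. -/
def coeffQ' (R : ℝ) : ℝ :=
  (((R - 1) ^ 2 * (R + 1) + 2 * R * (R - 1) * (R + 1) + R * (R - 1) ^ 2
      + 2 * (8 * R ^ 3 + 21 * R ^ 2 + 28 * R + 7)) * (R * (R + 1))
    - (R * (R - 1) ^ 2 * (R + 1) + 2 * quartic R) * (7 * R + 2)) / (2 * R ^ 3 * (R + 1) ^ 6)

theorem hasDerivAt_coeffQ {R : ℝ} (hR : 0 < R) : HasDerivAt coeffQ (coeffQ' R) R := by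
  have h := ((((hasDerivAt_id R).mul (((hasDerivAt_id R).sub_const 1).pow 2)).mul
    ((hasDerivAt_id R).add_const 1)).add ((hasDerivAt_quartic R).const_mul 2)).div
      (((hasDerivAt_pow 2 R).const_mul 2).mul (((hasDerivAt_id R).add_const 1).pow 5))
      (by simp only [id, Pi.mul_apply, Pi.pow_apply]; positivity)
  refine h.congr_deriv ?_
  simp only [id, Pi.mul_apply, Pi.pow_apply, Pi.add_apply, coeffQ']
  field_simp
  push_cast
  ring

/-- In the area radius this is 4m'/r² = 8(r - 4)/r⁵. -/
theorem scalarCurvature_example {x : E3} (hx : x ≠ 0) :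
    scalarCurvature exampleMetric x = 8 * ‖x‖ ^ 4 * (‖x‖ - 1) ^ 2 / (‖x‖ + 1) ^ 10 := by
  have hn : 0 < ‖x‖ := norm_pos_iff.2 hx
  have hq := quartic_pos hn
  -- Differentiability suffices: the value of the derivative does not enter the scalar curvature.
  have hS : DifferentiableAt ℝ coeffS ‖x‖ := by
    have h := (hasDerivAt_quartic ‖x‖).differentiableAt
    unfold coeffS
    refine .fun_div (by fun_prop) (by fun_prop) (by positivity)
  rw [exampleMetric, scalarCurvature_radialMetric hx (coeffα_pos hn).ne'
    (radialCoeff_example_pos hn).ne' ?_ (hasDerivAt_coeffP hn) (hasDerivAt_coeffQ hn)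
    hS.hasDerivAt, radialCoeff_example hn]
  · unfold coeffα coeffP coeffQ coeffQ' coeffS
    generalize ‖x‖ = R at *
    field_simp
    unfold quartic
    ring
  · intro k i j
    filter_upwards [isOpen_ne.mem_nhds hx] with y hy using christoffel_example hy k i j

/-! ### Decay at infinity -/

/-- The filter at infinity has a basis of open sets. Hence identities valid near infinity may be
differentiated. -/
theorem eventually_cobounded_nhds {p : E3 → Prop} (h : ∀ᶠ x in Bornology.cobounded E3, p x) :
    ∀ᶠ x in Bornology.cobounded E3, ∀ᶠ y in 𝓝 x, p y := by
  have hb := Metric.hasBasis_cobounded_compl_closedBall (0 : E3)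
  obtain ⟨r, -, hr⟩ := hb.eventually_iff.1 h
  refine hb.eventually_iff.2 ⟨r, trivial, fun x hx => ?_⟩
  filter_upwards [Metric.isClosed_closedBall.isOpen_compl.mem_nhds hx] with y hy using hr hy

theorem eventually_cobounded_of_norm {p : E3 → Prop} (r : ℝ) (h : ∀ x : E3, r < ‖x‖ → p x) :
    ∀ᶠ x in Bornology.cobounded E3, p x := by
  refine (Metric.hasBasis_cobounded_compl_closedBall (0 : E3)).eventually_iff.2
    ⟨r, trivial, fun x hx => h x ?_⟩
  simpa using hx

theorem eventually_cobounded_ne_zero : ∀ᶠ x in Bornology.cobounded E3, x ≠ 0 :=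
  eventually_cobounded_of_norm 0 fun _ hx => norm_pos_iff.1 hx

theorem pd_congr_cobounded {f h : E3 → ℝ} (k : Fin 3) (hfh : f =ᶠ[Bornology.cobounded E3] h) :
    pd k f =ᶠ[Bornology.cobounded E3] pd k h := by
  filter_upwards [eventually_cobounded_nhds hfh] with x hx using pd_congr k hx

/-- The partial derivatives of `f` of order `l ≤ n` exist and are `O(|x|⁻ᵖ⁻ˡ)` at infinity. -/
def Decays : ℕ → ℕ → (E3 → ℝ) → Prop
  | 0, p, f => f =O[Bornology.cobounded E3] fun x => (‖x‖ ^ p)⁻¹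
  | n + 1, p, f => f =O[Bornology.cobounded E3] (fun x => (‖x‖ ^ p)⁻¹) ∧
      (∀ᶠ x in Bornology.cobounded E3, DifferentiableAt ℝ f x) ∧ ∀ k, Decays n (p + 1) (pd k f)

namespace Decays

variable {n p q : ℕ} {f h : E3 → ℝ}

theorem decaysTwice (hf : Decays 2 p f) : DecaysTwice p f :=
  ⟨hf.1, fun k => (hf.2.2 k).1, fun k l => (hf.2.2 k).2.2 l⟩

theorem of_succ (hf : Decays (n + 1) p f) : Decays n p f := by
  induction n generalizing p f with
  | zero => exact hf.1
  | succ n ih => exact ⟨hf.1, hf.2.1, fun k => ih (hf.2.2 k)⟩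

theorem congr (hf : Decays n p f) (hfh : f =ᶠ[Bornology.cobounded E3] h) : Decays n p h := by
  induction n generalizing p f h with
  | zero => exact hf.congr' hfh .rfl
  | succ n ih =>
    refine ⟨hf.1.congr' hfh .rfl, ?_, fun k => ih (hf.2.2 k) (pd_congr_cobounded k hfh)⟩
    filter_upwards [hf.2.1, eventually_cobounded_nhds hfh] with x hx hx'
      using (EventuallyEq.differentiableAt_iff hx').1 hx

theorem zero : Decays n p fun _ => 0 := by
  induction n generalizing p with
  | zero => exact isBigO_zero _ _
  | succ n ih =>
    refine ⟨isBigO_zero _ _, .of_forall fun x => differentiableAt_const _, fun k => ?_⟩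
    exact ih.congr (.of_forall fun x => (pd_const k 0 x).symm)

theorem const (c : ℝ) : Decays n 0 fun _ => c := by
  have h0 : (fun _ : E3 => c) =O[Bornology.cobounded E3] fun x => (‖x‖ ^ 0)⁻¹ := by
    simpa using isBigO_const_const c (one_ne_zero (α := ℝ)) (Bornology.cobounded E3)
  cases n with
  | zero => exact h0
  | succ n =>
    refine ⟨h0, .of_forall fun x => differentiableAt_const _, fun k => ?_⟩
    exact zero.congr (.of_forall fun x => (pd_const k c x).symm)

theorem add (hf : Decays n p f) (hh : Decays n p h) : Decays n p fun x => f x + h x := by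
  induction n generalizing p f h with
  | zero => exact IsBigO.add hf hh
  | succ n ih =>
    refine ⟨hf.1.add hh.1, ?_, fun k => (ih (hf.2.2 k) (hh.2.2 k)).congr ?_⟩
    · filter_upwards [hf.2.1, hh.2.1] with x h1 h2 using h1.fun_add h2
    · filter_upwards [hf.2.1, hh.2.1] with x h1 h2 using (pd_add k h1 h2).symm

theorem mul (hf : Decays n p f) (hh : Decays n q h) : Decays n (p + q) fun x => f x * h x := by
  induction n generalizing p q f h with
  | zero => exact (IsBigO.mul hf hh).congr_right fun x => by rw [pow_add, mul_inv]
  | succ n ih =>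
    refine ⟨(hf.1.mul hh.1).congr_right fun x => by rw [pow_add, mul_inv], ?_, fun k => ?_⟩
    · filter_upwards [hf.2.1, hh.2.1] with x h1 h2 using h1.fun_mul h2
    · have h1 := ih (hf.2.2 k) hh.of_succ
      have h2 := ih hf.of_succ (hh.2.2 k)
      rw [show p + 1 + q = p + q + 1 by ring] at h1
      refine (h1.add h2).congr ?_
      filter_upwards [hf.2.1, hh.2.1] with x h1 h2 using (pd_mul k h1 h2).symm

theorem isBigO_inv_norm_pow_succ (p : ℕ) :
    (fun x : E3 => (‖x‖ ^ (p + 1))⁻¹) =O[Bornology.cobounded E3] fun x => (‖x‖ ^ p)⁻¹ := by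
  refine .of_bound 1 (eventually_cobounded_of_norm 1 fun x hx => ?_)
  have h0 : 0 < ‖x‖ := one_pos.trans hx
  rw [Real.norm_of_nonneg (by positivity), Real.norm_of_nonneg (by positivity), one_mul]
  exact inv_anti₀ (by positivity) (pow_le_pow_right₀ hx.le (Nat.le_succ p))

theorem mono (hf : Decays n (p + 1) f) : Decays n p f := by
  induction n generalizing p f with
  | zero => exact IsBigO.trans hf (isBigO_inv_norm_pow_succ p)
  | succ n ih =>
    exact ⟨hf.1.trans (isBigO_inv_norm_pow_succ p), hf.2.1, fun k => ih (hf.2.2 k)⟩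

theorem const_mul (c : ℝ) (hf : Decays n p f) : Decays n p fun x => c * f x := by
  simpa using (const c).mul hf

theorem pow (hf : Decays n p f) (k : ℕ) : Decays n (k * p) fun x => f x ^ k := by
  induction k with
  | zero => simpa using const 1
  | succ k ih => simpa [pow_succ, add_mul] using ih.mul hf

/-- Induction through ∂ₖ(1/f) = -∂ₖf · f⁻²: the lower bound controls 1/f, and the derivative of f
supplies the extra decay. -/
theorem inv (hf : Decays n 0 f) {c : ℝ} (hc : 0 < c)
    (hfc : ∀ᶠ x in Bornology.cobounded E3, c ≤ |f x|) : Decays n 0 fun x => (f x)⁻¹ := by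
  have h0 : (fun x => (f x)⁻¹) =O[Bornology.cobounded E3] fun x => (‖x‖ ^ 0)⁻¹ := by
    refine IsBigO.of_bound c⁻¹ ?_
    filter_upwards [hfc] with x hx
    simpa using inv_anti₀ hc hx
  induction n with
  | zero => exact h0
  | succ n ih =>
    have hne : ∀ᶠ x in Bornology.cobounded E3, f x ≠ 0 := by
      filter_upwards [hfc] with x hx
      exact abs_pos.1 (hc.trans_le hx)
    refine ⟨h0, ?_, fun k => ?_⟩
    · filter_upwards [hf.2.1, hne] with x h1 h2 using h1.fun_inv h2
    · have h1 := ih hf.of_succ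
      refine (((hf.2.2 k).mul (h1.mul h1)).const_mul (-1)).congr ?_
      filter_upwards [hf.2.1, hne] with x h1 h2
      rw [pd_inv k h1 h2]
      ring

end Decays

theorem pd_inv_norm {x : E3} (hx : x ≠ 0) (k : Fin 3) :
    pd k (fun y => ‖y‖⁻¹) x = -1 * (radial x k * (‖x‖⁻¹ * ‖x‖⁻¹)) := by
  have hn : ‖x‖ ≠ 0 := norm_ne_zero_iff.2 hx
  rw [pd_comp_norm hx (hasDerivAt_inv hn) k, radial]
  field_simp

theorem differentiableAt_inv_norm {x : E3} (hx : x ≠ 0) :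
    DifferentiableAt ℝ (fun y : E3 => ‖y‖⁻¹) x :=
  differentiableAt_comp_norm hx (differentiableAt_inv (norm_ne_zero_iff.2 hx))

theorem differentiableAt_radial {x : E3} (hx : x ≠ 0) (i : Fin 3) :
    DifferentiableAt ℝ (fun y : E3 => radial y i) x :=
  (differentiableAt_coord i x).fun_mul (differentiableAt_inv_norm hx)

theorem pd_radial {x : E3} (hx : x ≠ 0) (k i : Fin 3) :
    pd k (fun y => radial y i) x
      = (kron i k + -1 * (radial x i * radial x k)) * ‖x‖⁻¹ := by
  simp only [radial, div_eq_mul_inv]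
  rw [pd_mul k (differentiableAt_coord i x) (differentiableAt_inv_norm hx), pd_coord,
    pd_inv_norm hx, radial]
  ring

theorem abs_radial_le (x : E3) (i : Fin 3) : |radial x i| ≤ 1 := by
  rw [radial, abs_div, abs_norm]
  exact div_le_one_of_le₀ (PiLp.norm_apply_le x i) (norm_nonneg x)

/-- The induction has to be joint: the derivatives of 1/|x| and of x/|x| are polynomials in both. -/
theorem decays_inv_norm_and_radial (n : ℕ) :
    (Decays n 1 fun x => ‖x‖⁻¹) ∧ ∀ i, Decays n 0 fun x => radial x i := by
  have h1 : (fun x : E3 => ‖x‖⁻¹) =O[Bornology.cobounded E3] fun x => (‖x‖ ^ 1)⁻¹ := by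
    simpa using isBigO_refl _ _
  have h2 : ∀ i, (fun x : E3 => radial x i) =O[Bornology.cobounded E3] fun x => (‖x‖ ^ 0)⁻¹ :=
    fun i => .of_bound 1 (.of_forall fun x => by simpa using abs_radial_le x i)
  induction n with
  | zero => exact ⟨h1, h2⟩
  | succ n ih =>
    refine ⟨⟨h1, ?_, fun k => ?_⟩, fun i => ⟨h2 i, ?_, fun k => ?_⟩⟩
    · filter_upwards [eventually_cobounded_ne_zero] with x hx using differentiableAt_inv_norm hx
    · refine (((ih.2 k).mul (ih.1.mul ih.1)).const_mul (-1)).congr ?_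
      filter_upwards [eventually_cobounded_ne_zero] with x hx using (pd_inv_norm hx k).symm
    · filter_upwards [eventually_cobounded_ne_zero] with x hx using differentiableAt_radial hx i
    · have := ((Decays.const (n := n) (kron i k)).add
        (((ih.2 i).mul (ih.2 k)).const_mul (-1))).mul ih.1
      refine this.congr ?_
      filter_upwards [eventually_cobounded_ne_zero] with x hx using (pd_radial hx k i).symm

theorem decays_inv_norm (n : ℕ) : Decays n 1 fun x => ‖x‖⁻¹ := (decays_inv_norm_and_radial n).1

theorem decays_radial (n : ℕ) (i : Fin 3) : Decays n 0 fun x => radial x i :=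
  (decays_inv_norm_and_radial n).2 i

/-- With u = 1/|x| and n = x/|x|, one has α - 1 = u(4 + 6u + 4u² + u³) and β xᵢxⱼ = u (1+u)⁴(1-u)²
L(u)⁻¹ nᵢnⱼ, where L(u) = u⁴ `quartic`(1/u). The leading factor u is the required decay. -/
theorem decays_example_metric (i j : Fin 3) :
    Decays 2 1 fun x => exampleMetric x i j - (1 : Matrix (Fin 3) (Fin 3) ℝ) i j := by
  have hu := decays_inv_norm 2
  have hu0 := hu.mono
  have hpow : ∀ k, Decays 2 0 fun x : E3 => ‖x‖⁻¹ ^ k := fun k => hu0.pow k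
  have h1 := Decays.const (n := 2) 1
  have hA : Decays 2 1 fun x : E3 => ‖x‖⁻¹ *
      (4 + (6 * ‖x‖⁻¹ + (4 * ‖x‖⁻¹ ^ 2 + ‖x‖⁻¹ ^ 3))) :=
    hu.mul ((Decays.const 4).add ((hu0.const_mul 6).add (((hpow 2).const_mul 4).add (hpow 3))))
  have hL : Decays 2 0 fun x : E3 => 2 + (7 * ‖x‖⁻¹ + (14 * ‖x‖⁻¹ ^ 2 + (7 * ‖x‖⁻¹ ^ 3
      + 2 * ‖x‖⁻¹ ^ 4))) :=
    (Decays.const 2).add ((hu0.const_mul 7).add (((hpow 2).const_mul 14).add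
      (((hpow 3).const_mul 7).add ((hpow 4).const_mul 2))))
  -- The lower bound 2 is the constant term of L; the other terms are nonnegative.
  have hLi := hL.inv (c := 2) two_pos (.of_forall fun x => by
    rw [abs_of_nonneg (by positivity)]
    have : 0 ≤ 7 * ‖x‖⁻¹ + (14 * ‖x‖⁻¹ ^ 2 + (7 * ‖x‖⁻¹ ^ 3 + 2 * ‖x‖⁻¹ ^ 4)) := by positivity
    linarith)
  have hB : Decays 2 1 fun x : E3 => ‖x‖⁻¹ * ((1 + ‖x‖⁻¹) ^ 4 * (1 + -1 * ‖x‖⁻¹) ^ 2 *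
      (2 + (7 * ‖x‖⁻¹ + (14 * ‖x‖⁻¹ ^ 2 + (7 * ‖x‖⁻¹ ^ 3 + 2 * ‖x‖⁻¹ ^ 4))))⁻¹) :=
    hu.mul ((((h1.add hu0).pow 4).mul ((h1.add (hu0.const_mul (-1))).pow 2)).mul hLi)
  have hnn : Decays 2 0 fun x : E3 => radial x i * radial x j :=
    (decays_radial 2 i).mul (decays_radial 2 j)
  refine ((hA.mul (Decays.const (kron i j))).add (hB.mul hnn)).congr ?_
  filter_upwards [eventually_cobounded_ne_zero] with x hx
  have hn : 0 < ‖x‖ := norm_pos_iff.2 hx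
  have hq := quartic_pos hn
  simp only [exampleMetric, radialMetric, coeffα, coeffβ, radial, Matrix.one_apply, kron]
  generalize ‖x‖ = R at *
  unfold quartic at *
  field_simp
  ring

/-- The radial component of the electric field. -/
def coeffE (R : ℝ) : ℝ := 2 * R ^ 4 * (R - 1) ^ 3 / (R + 1) ^ 9

/-- The electric field of the example. -/
def exampleField (x : E3) : E3 := (coeffE ‖x‖ / ‖x‖) • x

theorem exampleField_apply (x : E3) (i : Fin 3) :
    exampleField x i = coeffE ‖x‖ * radial x i := by
  simp [exampleField, radial]
  ring

/-- With u = 1/|x|, the radial component is 2u²(1-u)³(1+u)⁻⁹. -/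
theorem decays_example_field (i : Fin 3) : Decays 2 2 fun x => exampleField x i := by
  have hu := decays_inv_norm 2
  have hu0 := hu.mono
  have h1 := Decays.const (n := 2) 1
  have hi := (h1.add hu0).inv one_pos (.of_forall fun x => by
    rw [abs_of_nonneg (by positivity)]
    have : 0 ≤ ‖x‖⁻¹ := by positivity
    linarith)
  have h := ((hu.mul hu).mul (((h1.add (hu0.const_mul (-1))).pow 3).mul
    ((hi.pow 9).mul ((decays_radial 2 i).const_mul 2))))
  refine Decays.congr h ?_
  filter_upwards [eventually_cobounded_ne_zero] with x hx
  have hn : 0 < ‖x‖ := norm_pos_iff.2 hx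
  simp only [exampleField_apply, coeffE]
  generalize ‖x‖ = R at *
  field_simp
  ring

theorem isBigO_example_scalarCurvature :
    scalarCurvature exampleMetric =O[Bornology.cobounded E3] fun x => (‖x‖ ^ 4)⁻¹ := by
  refine .of_bound 8 (eventually_cobounded_of_norm 1 fun x hx => ?_)
  have hn : 0 < ‖x‖ := one_pos.trans hx
  rw [scalarCurvature_example (norm_pos_iff.1 hn), Real.norm_of_nonneg (by positivity),
    Real.norm_of_nonneg (by positivity), div_le_iff₀ (by positivity), mul_assoc, mul_assoc]
  refine mul_le_mul_of_nonneg_left ?_ (by norm_num)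
  rw [← div_eq_inv_mul, le_div_iff₀ (by positivity)]
  calc ‖x‖ ^ 4 * (‖x‖ - 1) ^ 2 * ‖x‖ ^ 4
      ≤ (‖x‖ + 1) ^ 4 * (‖x‖ + 1) ^ 2 * (‖x‖ + 1) ^ 4 := by gcongr <;> linarith
    _ = (‖x‖ + 1) ^ 10 := by ring

/-! ### Surface integrals and fluxes -/

theorem sphereIntegral_of_forall {R c : ℝ} {φ : E3 → ℝ} (hR : 0 < R)
    (h : ∀ x : E3, ‖x‖ = R → φ x = c) : sphereIntegral R φ = 4 * Real.pi * R ^ 2 * c := by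
  have h1 : ∀ u : Metric.sphere (0 : E3) 1, φ (R • (u : E3)) = c := by
    intro u
    apply h
    rw [norm_smul, Real.norm_of_nonneg hR.le, norm_eq_of_mem_sphere u, mul_one]
  -- The total mass of `toSphere` is the dimension times the volume of the unit ball, here 3 · 4π/3.
  have h2 : (volume : Measure E3).real (Metric.ball 0 1) = Real.pi * 4 / 3 := by
    rw [measureReal_def, EuclideanSpace.volume_ball_fin_three]
    simp
    positivity
  rw [sphereIntegral]
  simp only [h1]
  rw [integral_const, Measure.toSphere_real_apply_univ, h2]
  simp
  ring

section RadialMetric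

variable {α β : ℝ → ℝ} {x : E3}

theorem sum_radial_sq (hx : x ≠ 0) : ∑ i, radial x i ^ 2 = 1 := by
  have hn : ‖x‖ ≠ 0 := norm_ne_zero_iff.2 hx
  have h := norm_sq_eq_sum x
  simp only [radial, Fin.sum_univ_three, div_pow]
  field_simp
  exact h.symm

theorem sum_mul_radial (hx : x ≠ 0) : ∑ i, x i * radial x i = ‖x‖ := by
  have hn : ‖x‖ ≠ 0 := norm_ne_zero_iff.2 hx
  have h := norm_sq_eq_sum x
  simp only [radial, Fin.sum_univ_three]
  field_simp
  exact h.symm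

theorem covectorNormSq_radial (hx : x ≠ 0) (hα : 0 < α ‖x‖) (hγ : 0 < radialCoeff α β ‖x‖) :
    covectorNormSq (radialMetric α β) x (radial x) = (radialCoeff α β ‖x‖)⁻¹ := by
  have hB : radialCoeff α β ‖x‖ = α ‖x‖ + β ‖x‖ * ‖x‖ ^ 2 := rfl
  rw [covectorNormSq_radialMetric hα.ne' hγ.ne', sum_radial_sq hx, sum_mul_radial hx]
  generalize radialCoeff α β ‖x‖ = γ at *
  field_simp
  linear_combination hB

theorem areaDensity_radialMetric (hx : x ≠ 0) (hα : 0 < α ‖x‖)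
    (hγ : 0 < radialCoeff α β ‖x‖) : areaDensity (radialMetric α β) x = α ‖x‖ := by
  rw [areaDensity, covectorNormSq_radial hx hα hγ, radialMetric_det, mul_assoc,
    mul_inv_cancel₀ hγ.ne', mul_one, Real.sqrt_sq hα.le]

theorem unitDual_radial (hx : x ≠ 0) (hα : 0 < α ‖x‖) (hγ : 0 < radialCoeff α β ‖x‖) :
    unitDual (radialMetric α β) x (radial x) = (√(radialCoeff α β ‖x‖) * ‖x‖)⁻¹ • x := by
  have hB : radialCoeff α β ‖x‖ = α ‖x‖ + β ‖x‖ * ‖x‖ ^ 2 := rfl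
  have hn : ‖x‖ ≠ 0 := norm_ne_zero_iff.2 hx
  ext i
  simp only [unitDual]
  rw [sum_radialMetric_inv_mul hα.ne' hγ.ne', covectorNormSq_radial hx hα hγ, sum_mul_radial hx,
    Real.sqrt_inv]
  have hs := Real.sq_sqrt hγ.le
  have hs0 := Real.sqrt_pos.2 hγ
  simp only [PiLp.smul_apply, smul_eq_mul, radial]
  rw [← hs] at hB ⊢
  rw [Real.sqrt_sq hs0.le]
  generalize √(radialCoeff α β ‖x‖) = γ at *
  field_simp
  linear_combination x i * hB

theorem metricInner_radial {e : ℝ} (hx : x ≠ 0) (hα : 0 < α ‖x‖) (hγ : 0 < radialCoeff α β ‖x‖) :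
    metricInner (radialMetric α β) x ((e / ‖x‖) • x)
      (unitDual (radialMetric α β) x (radial x)) = e * √(radialCoeff α β ‖x‖) := by
  have hB : radialCoeff α β ‖x‖ = α ‖x‖ + β ‖x‖ * ‖x‖ ^ 2 := rfl
  have hn : ‖x‖ ≠ 0 := norm_ne_zero_iff.2 hx
  have hs := Real.sq_sqrt hγ.le
  have hs0 := Real.sqrt_pos.2 hγ
  rw [unitDual_radial hx hα hγ, metricInner_radialMetric]
  simp only [inner_smul_left, inner_smul_right, real_inner_self_eq_norm_sq, map_div₀,
    conj_trivial]
  rw [← hs] at hB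
  generalize √(radialCoeff α β ‖x‖) = γ at *
  field_simp
  linear_combination -e * hB

theorem adm_integrand {α' β' : ℝ} (hx : x ≠ 0) (hα : HasDerivAt α α' ‖x‖)
    (hβ : HasDerivAt β β' ‖x‖) :
    ∑ i, ∑ j, (pd j (fun y => radialMetric α β y i j) x
      - pd i (fun y => radialMetric α β y j j) x) * radial x i
      = 2 * β ‖x‖ * ‖x‖ - 2 * α' := by
  have hn : ‖x‖ ≠ 0 := norm_ne_zero_iff.2 hx
  simp only [pd_radialMetric hx hα hβ]
  have e : ∀ i, ∑ j, (α' / ‖x‖ * x j * kron i j + β' / ‖x‖ * x j * (x i * x j)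
      + β ‖x‖ * (kron i j * x j + x i * kron j j)
      - (α' / ‖x‖ * x i * kron j j + β' / ‖x‖ * x i * (x j * x j)
      + β ‖x‖ * (kron j i * x j + x j * kron j i))) * radial x i
      = (2 * β ‖x‖ - 2 * α' / ‖x‖) * (x i * radial x i) := by
    intro i
    fin_cases i <;> simp [Fin.sum_univ_three, kron] <;> ring
  simp only [e]
  rw [← Finset.mul_sum, sum_mul_radial hx]
  field_simp

theorem divergence_radialMetric {h : ℝ → ℝ} {h' : ℝ} {V : E3 → E3} (hx : x ≠ 0)
    (hV : ∀ i, (fun y => √(radialMetric α β y).det * V y i) =ᶠ[𝓝 x] fun y => h ‖y‖ * y i)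
    (hh : HasDerivAt h h' ‖x‖) :
    divergence (radialMetric α β) V x
      = (√(radialMetric α β x).det)⁻¹ * (h' * ‖x‖ + 3 * h ‖x‖) := by
  have hn : ‖x‖ ≠ 0 := norm_ne_zero_iff.2 hx
  have e : h' * ‖x‖ = h' / ‖x‖ * ‖x‖ ^ 2 := by field_simp
  rw [divergence, e, norm_sq_eq_sum x]
  simp only [fun i => pd_congr i (hV i),
    fun i => pd_comp_norm_mul hx hh i (differentiableAt_coord i x), pd_coord]
  simp [kron, Fin.sum_univ_three]
  left
  ring

end RadialMetric

/-! ### Area, ADM mass and charge of the example -/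

theorem sphereArea_example : sphereArea exampleMetric 1 = 4 * Real.pi * 4 ^ 2 := by
  rw [sphereArea, sphereIntegral_of_forall (c := 16) one_pos]
  · norm_num
  · intro x hx
    have hn : 0 < ‖x‖ := by rw [hx]; exact one_pos
    rw [exampleMetric, areaDensity_radialMetric (norm_pos_iff.1 hn) (coeffα_pos hn)
      (radialCoeff_example_pos hn), hx]
    norm_num [coeffα]

theorem tendsto_admIntegral_example : Tendsto (admIntegral exampleMetric) atTop (𝓝 (9 / 4)) := by
  -- In u = 1/R the mass integral extends continuously to u = 0, with value (1/2)(1/2 + 4) = 9/4.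
  have h : ContinuousAt (fun u : ℝ => (1 / 2) * ((1 + u) ^ 4 * (1 - u) ^ 2 /
      (2 + 7 * u + 14 * u ^ 2 + 7 * u ^ 3 + 2 * u ^ 4) + 4 * (1 + u) ^ 3)) 0 :=
    .mul continuousAt_const (.add (.div (by fun_prop) (by fun_prop) (by norm_num)) (by fun_prop))
  have h2 := h.tendsto.comp tendsto_inv_atTop_zero
  norm_num at h2
  refine h2.congr' ?_
  filter_upwards [eventually_gt_atTop 0] with R hR
  rw [admIntegral, sphereIntegral_of_forall (c := 2 * coeffβ R * R
    - 2 * (-4 * (R + 1) ^ 3 / R ^ 5)) hR]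
  · have hq := quartic_pos hR
    have hpi := Real.pi_pos
    simp only [Function.comp, coeffβ]
    unfold quartic at *
    field_simp
    ring
  · rintro x rfl
    exact adm_integrand (norm_pos_iff.1 hR) (hasDerivAt_coeffα hR) (hasDerivAt_coeffβ hR)

/-- The charge enclosed by the coordinate sphere of radius `R`. -/
def exampleCharge (R : ℝ) : ℝ :=
  2 * R ^ 2 * (R - 1) ^ 3 / (R + 1) ^ 5 * √(radialCoeff coeffα coeffβ R)

theorem sphereCharge_example {R : ℝ} (hR : 0 < R) :
    sphereCharge exampleMetric exampleField R = exampleCharge R := by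
  rw [sphereCharge, sphereIntegral_of_forall
    (c := coeffE R * √(radialCoeff coeffα coeffβ R) * coeffα R) hR]
  · have hpi := Real.pi_pos
    rw [exampleCharge, coeffE, coeffα]
    field_simp
  · rintro x rfl
    have hx := norm_pos_iff.1 hR
    rw [exampleMetric, exampleField, metricInner_radial hx (coeffα_pos hR)
      (radialCoeff_example_pos hR), areaDensity_radialMetric hx (coeffα_pos hR)
      (radialCoeff_example_pos hR)]

theorem tendsto_exampleCharge : Tendsto exampleCharge atTop (𝓝 2) := by
  have h : ContinuousAt (fun u : ℝ => 2 * (1 - u) ^ 3 / (1 + u) ^ 5 *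
      √(2 * (1 + u) ^ 8 / (2 + 7 * u + 14 * u ^ 2 + 7 * u ^ 3 + 2 * u ^ 4))) 0 :=
    .mul (.div (by fun_prop) (by fun_prop) (by norm_num))
      (.sqrt (.div (by fun_prop) (by fun_prop) (by norm_num)))
  have h2 := h.tendsto.comp tendsto_inv_atTop_zero
  norm_num at h2
  refine h2.congr' ?_
  filter_upwards [eventually_gt_atTop 0] with R hR
  have hq := quartic_pos hR
  rw [exampleCharge, radialCoeff_example hR]
  simp only [Function.comp]
  congr 1
  · field_simp
  · congr 1
    unfold quartic at *
    field_simp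

/-- A charge that stays strictly below its limit is not eventually constant. -/
theorem exampleCharge_lt {R : ℝ} (hR : 0 < R) : exampleCharge R < 2 := by
  have hq := quartic_pos hR
  refine lt_of_pow_lt_pow_left₀ 2 two_pos.le ?_
  rw [exampleCharge, mul_pow, Real.sq_sqrt (radialCoeff_example_pos hR).le,
    radialCoeff_example hR]
  have e : (2 * R ^ 2 * (R - 1) ^ 3 / (R + 1) ^ 5) ^ 2 * (2 * (R + 1) ^ 8 / (R ^ 4 * quartic R))
      = 8 * (R - 1) ^ 6 / ((R + 1) ^ 2 * quartic R) := by
    field_simp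
    ring
  rw [e, div_lt_iff₀ (by positivity)]
  have h1 : (R - 1) ^ 6 ≤ (R + 1) ^ 2 * (R - 1) ^ 4 := by
    rw [show (R - 1) ^ 6 = (R - 1) ^ 2 * (R - 1) ^ 4 by ring]
    refine mul_le_mul_of_nonneg_right ?_ (by positivity)
    nlinarith
  -- In the area radius, (r - 4)² < r² - r/2 + 2, the inequality behind the energy condition.
  have h2 : 2 * (R - 1) ^ 4 < quartic R := by
    have : 0 < 15 * R ^ 3 + 2 * R ^ 2 + 15 * R := by positivity
    unfold quartic
    linear_combination this
  have h3 := mul_lt_mul_of_pos_left h2 (show 0 < (R + 1) ^ 2 by positivity)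
  linarith

theorem sqrt_det_example {x : E3} (hx : x ≠ 0) :
    √(exampleMetric x).det = coeffα ‖x‖ * √(radialCoeff coeffα coeffβ ‖x‖) := by
  rw [exampleMetric, radialMetric_det, Real.sqrt_mul (by positivity),
    Real.sqrt_sq (coeffα_pos (norm_pos_iff.2 hx)).le]

theorem differentiableAt_radialCoeff_example {R : ℝ} (hR : 0 < R) :
    DifferentiableAt ℝ (radialCoeff coeffα coeffβ) R :=
  (hasDerivAt_coeffα hR).differentiableAt.fun_add
    ((hasDerivAt_coeffβ hR).differentiableAt.fun_mul (by fun_prop))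

theorem differentiableAt_exampleCharge {R : ℝ} (hR : 0 < R) :
    DifferentiableAt ℝ exampleCharge R := by
  have h := (differentiableAt_radialCoeff_example hR).sqrt (radialCoeff_example_pos hR).ne'
  exact .fun_mul (.fun_div (by fun_prop) (by fun_prop) (by positivity)) h

/-- Gauss's law: √det g · Eⁱ = Q(R) xᵢ/R³, and xᵢ/R³ is divergence free in Euclidean space, so only
Q' survives. -/
theorem divergence_exampleField {x : E3} (hx : x ≠ 0) :
    divergence exampleMetric exampleField x
      = (√(exampleMetric x).det * ‖x‖ ^ 2)⁻¹ * deriv exampleCharge ‖x‖ := by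
  have hn : 0 < ‖x‖ := norm_pos_iff.2 hx
  have hd := ((differentiableAt_exampleCharge hn).hasDerivAt.div (hasDerivAt_pow 3 ‖x‖)
    (by positivity))
  rw [exampleMetric, divergence_radialMetric hx (h := fun R => exampleCharge R / R ^ 3) ?_ hd]
  · generalize deriv exampleCharge ‖x‖ = d
    simp only [mul_inv]
    field_simp
    push_cast
    ring
  · intro i
    filter_upwards [isOpen_ne.mem_nhds hx] with y hy
    have hy0 : 0 < ‖y‖ := norm_pos_iff.2 hy
    have e := sqrt_det_example hy
    rw [exampleMetric] at e
    rw [e, exampleField_apply, coeffα, coeffE, radial, exampleCharge]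
    field_simp

/-- Otherwise the enclosed charge would be constant beyond some radius, hence equal to its limit 2,
which it never reaches. -/
theorem exists_divergence_exampleField_ne_zero (r : ℝ) :
    ∃ x : E3, r < ‖x‖ ∧ divergence exampleMetric exampleField x ≠ 0 := by
  by_contra! h
  have hs : ∀ R ∈ Ioi (max r 0), 0 < R := fun R hR => (le_max_right r 0).trans_lt hR
  have h1 : ∀ R ∈ Ioi (max r 0), deriv exampleCharge R = 0 := by
    intro R hR
    have hR0 := hs R hR
    have hn : ‖EuclideanSpace.single (0 : Fin 3) R‖ = R := by
      rw [PiLp.norm_single, Real.norm_of_nonneg hR0.le]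
    have hx : (EuclideanSpace.single (0 : Fin 3) R : E3) ≠ 0 :=
      norm_pos_iff.1 (by rw [hn]; exact hR0)
    have h2 := h (EuclideanSpace.single 0 R)
      (by rw [hn]; exact (le_max_left r 0).trans_lt hR)
    rw [divergence_exampleField hx, sqrt_det_example hx, hn] at h2
    have h3 := coeffα_pos hR0
    have h4 := Real.sqrt_pos.2 (radialCoeff_example_pos hR0)
    exact (mul_eq_zero.1 h2).resolve_left (by positivity)
  have hmem : max r 0 + 1 ∈ Ioi (max r 0) := by simp
  have h2 : ∀ R ∈ Ioi (max r 0), exampleCharge R = exampleCharge (max r 0 + 1) := by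
    intro R hR
    exact isOpen_Ioi.is_const_of_deriv_eq_zero isPreconnected_Ioi
      (fun y hy => (differentiableAt_exampleCharge (hs y hy)).differentiableWithinAt) h1 hR hmem
  have h3 : Tendsto exampleCharge atTop (𝓝 (exampleCharge (max r 0 + 1))) := by
    refine tendsto_const_nhds.congr' ?_
    filter_upwards [eventually_gt_atTop (max r 0)] with R hR using (h2 R hR).symm
  exact (exampleCharge_lt (hs _ hmem)).ne (tendsto_nhds_unique h3 tendsto_exampleCharge)

/-! ### Mean curvature -/

theorem pd_inv_sqrt {T : E3 → ℝ} {x : E3} (k : Fin 3) (hT : DifferentiableAt ℝ T x)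
    (h0 : 0 < T x) :
    pd k (fun y => (√(T y))⁻¹) x = -(1 / 2) * ((√(T x))⁻¹ / T x) * pd k T x := by
  have h1 := (hT.hasFDerivAt.sqrt h0.ne')
  have hs := Real.sqrt_pos.2 h0
  rw [pd_inv k h1.differentiableAt hs.ne', pd, h1.fderiv]
  simp only [pd]
  have h2 := Real.sq_sqrt h0.le
  rw [FunLike.coe_smul, Pi.smul_apply, smul_eq_mul]
  generalize √(T x) = s at *
  rw [← h2]
  field_simp

/-- The Euclidean divergence of √det g · ν for the unit normal ν of a level set: `a` and `κ` are the
coefficients of the inverse metric, `J` is √det g and `G` the gradient, radial at `x`. -/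
theorem sum_pd_normal {a κ J : ℝ → ℝ} {a' κ' J' lam : ℝ} {G : Fin 3 → E3 → ℝ} {x : E3}
    (hx : x ≠ 0) (ha : HasDerivAt a a' ‖x‖) (hκ : HasDerivAt κ κ' ‖x‖)
    (hJ : HasDerivAt J J' ‖x‖) (hG : ∀ i, DifferentiableAt ℝ (G i) x)
    (hGx : ∀ i, G i x = lam * x i) (hlam : lam ≠ 0) (hpos : 0 < a ‖x‖ - κ ‖x‖ * ‖x‖ ^ 2) :
    ∑ i, pd i (fun y => J ‖y‖ * ((a ‖y‖ * G i y + -κ ‖y‖ * (y i * ∑ j, y j * G j y)) *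
        (√(a ‖y‖ * ∑ j, G j y ^ 2 + -κ ‖y‖ * (∑ j, y j * G j y) ^ 2))⁻¹)) x
      = (√(lam ^ 2 * ‖x‖ ^ 2 * (a ‖x‖ - κ ‖x‖ * ‖x‖ ^ 2)))⁻¹ *
        (J' * lam * ‖x‖ * (a ‖x‖ - κ ‖x‖ * ‖x‖ ^ 2)
          + J ‖x‖ * (a ‖x‖ * ((∑ i, pd i (G i) x) - (∑ i, ∑ j, x i * x j * pd j (G i) x) / ‖x‖ ^ 2)
            - 2 * κ ‖x‖ * lam * ‖x‖ ^ 2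
            + lam * ‖x‖ / 2 * (a' - κ' * ‖x‖ ^ 2 - 2 * κ ‖x‖ * ‖x‖))) := by
  have hn : 0 < ‖x‖ := norm_pos_iff.2 hx
  have hsq := norm_sq_eq_sum x
  have da := differentiableAt_comp_norm hx ha.differentiableAt
  have hκ_neg := hκ.fun_neg
  have dκ := differentiableAt_comp_norm hx hκ_neg.differentiableAt
  have dJ := differentiableAt_comp_norm hx hJ.differentiableAt
  have dD : DifferentiableAt ℝ (fun y : E3 => ∑ j, y j * G j y) x := by fun_prop
  have dE : DifferentiableAt ℝ (fun y : E3 => ∑ j, G j y ^ 2) x := by fun_prop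
  have dY : ∀ i, DifferentiableAt ℝ
      (fun y : E3 => a ‖y‖ * G i y + -κ ‖y‖ * (y i * ∑ j, y j * G j y)) x := fun i =>
    .fun_add (.fun_mul da (hG i)) (.fun_mul dκ (.fun_mul (differentiableAt_coord i x) dD))
  have dT : DifferentiableAt ℝ
      (fun y : E3 => a ‖y‖ * ∑ j, G j y ^ 2 + -κ ‖y‖ * (∑ j, y j * G j y) ^ 2) x :=
    .fun_add (.fun_mul da dE) (.fun_mul dκ (.fun_pow dD 2))
  have hD : ∑ j, x j * G j x = lam * ‖x‖ ^ 2 := by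
    simp only [hGx, hsq, Fin.sum_univ_three]; ring
  have hE : ∑ j, G j x ^ 2 = lam ^ 2 * ‖x‖ ^ 2 := by
    simp only [hGx, hsq, Fin.sum_univ_three]; ring
  have hT : a ‖x‖ * ∑ j, G j x ^ 2 + -κ ‖x‖ * (∑ j, x j * G j x) ^ 2
      = lam ^ 2 * ‖x‖ ^ 2 * (a ‖x‖ - κ ‖x‖ * ‖x‖ ^ 2) := by
    rw [hD, hE]; ring
  have hTpos : 0 < lam ^ 2 * ‖x‖ ^ 2 * (a ‖x‖ - κ ‖x‖ * ‖x‖ ^ 2) := by positivity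
  have pD : ∀ i, pd i (fun y : E3 => ∑ j, y j * G j y) x
      = lam * x i + ∑ j, x j * pd i (G j) x := by
    intro i
    rw [pd_sum _ i (fun j _ => (differentiableAt_coord j x).fun_mul (hG j))]
    simp only [fun j => pd_mul i (differentiableAt_coord j x) (hG j), pd_coord, hGx]
    rw [Finset.sum_add_distrib]
    simp [kron]
  have pE : ∀ i, pd i (fun y : E3 => ∑ j, G j y ^ 2) x
      = 2 * lam * ∑ j, x j * pd i (G j) x := by
    intro i
    simp only [pow_two]
    rw [pd_sum _ i (fun j _ => (hG j).fun_mul (hG j))]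
    simp only [fun j => pd_mul i (hG j) (hG j), hGx, Finset.mul_sum]
    exact Finset.sum_congr rfl fun j _ => by ring
  have pT : ∀ i, pd i (fun y : E3 => a ‖y‖ * ∑ j, G j y ^ 2
        + -κ ‖y‖ * (∑ j, y j * G j y) ^ 2) x
      = a' / ‖x‖ * x i * (lam ^ 2 * ‖x‖ ^ 2) + a ‖x‖ * (2 * lam * ∑ j, x j * pd i (G j) x)
        - κ' / ‖x‖ * x i * (lam * ‖x‖ ^ 2) ^ 2
        - 2 * κ ‖x‖ * (lam * ‖x‖ ^ 2) * (lam * x i + ∑ j, x j * pd i (G j) x) := by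
    intro i
    rw [pd_add i (.fun_mul da dE) (.fun_mul dκ (.fun_pow dD 2)), pd_comp_norm_mul hx ha i dE,
      pd_comp_norm_mul hx hκ_neg i (.fun_pow dD 2), pE, hE]
    simp only [pow_two]
    rw [pd_mul i dD dD, pD, hD]
    ring
  have pY : ∀ i, pd i (fun y : E3 => a ‖y‖ * G i y + -κ ‖y‖ * (y i * ∑ j, y j * G j y)) x
      = a' / ‖x‖ * x i * (lam * x i) + a ‖x‖ * pd i (G i) x
        - κ' / ‖x‖ * x i * (x i * (lam * ‖x‖ ^ 2))
        - κ ‖x‖ * (lam * ‖x‖ ^ 2 + x i * (lam * x i + ∑ j, x j * pd i (G j) x)) := by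
    intro i
    rw [pd_add i (.fun_mul da (hG i))
        (.fun_mul dκ (.fun_mul (differentiableAt_coord i x) dD)),
      pd_comp_norm_mul hx ha i (hG i),
      pd_comp_norm_mul hx hκ_neg i (.fun_mul (differentiableAt_coord i x) dD),
      pd_mul i (differentiableAt_coord i x) dD, pD, hD, hGx, pd_coord]
    simp only [kron, if_true]
    ring
  have dS : DifferentiableAt ℝ (fun y : E3 =>
      (√(a ‖y‖ * ∑ j, G j y ^ 2 + -κ ‖y‖ * (∑ j, y j * G j y) ^ 2))⁻¹) x :=
    (dT.sqrt (by rw [hT]; exact hTpos.ne')).fun_inv (Real.sqrt_ne_zero'.2 (by rw [hT]; exact hTpos))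
  have hterm := fun i => pd_comp_norm_mul hx hJ i ((dY i).fun_mul dS)
  have key : ∀ i, pd i (fun y => J ‖y‖ *
        ((a ‖y‖ * G i y + -κ ‖y‖ * (y i * ∑ j, y j * G j y)) *
        (√(a ‖y‖ * ∑ j, G j y ^ 2 + -κ ‖y‖ * (∑ j, y j * G j y) ^ 2))⁻¹)) x
      = (√(lam ^ 2 * ‖x‖ ^ 2 * (a ‖x‖ - κ ‖x‖ * ‖x‖ ^ 2)))⁻¹ *
        ((J' * lam * (a ‖x‖ - κ ‖x‖ * ‖x‖ ^ 2) / ‖x‖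
            + J ‖x‖ * (a' * lam / (2 * ‖x‖) - κ' * lam * ‖x‖ / 2)) * x i ^ 2
          + J ‖x‖ * a ‖x‖ * pd i (G i) x
          - J ‖x‖ * a ‖x‖ / ‖x‖ ^ 2 * ∑ j, x i * x j * pd i (G j) x
          - J ‖x‖ * κ ‖x‖ * lam * ‖x‖ ^ 2) := by
    intro i
    rw [hterm, pd_mul i (dY i) dS, pd_inv_sqrt i dT (by rw [hT]; exact hTpos), pT, pY, hT, hD,
      hGx]
    simp only [mul_assoc (x i), ← Finset.mul_sum]
    generalize ∑ j, x j * pd i (G j) x = Z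
    generalize √(lam ^ 2 * ‖x‖ ^ 2 * (a ‖x‖ - κ ‖x‖ * ‖x‖ ^ 2)) = s
    have hh : a ‖x‖ = (a ‖x‖ - κ ‖x‖ * ‖x‖ ^ 2) + κ ‖x‖ * ‖x‖ ^ 2 := by ring
    generalize a ‖x‖ - κ ‖x‖ * ‖x‖ ^ 2 = h at *
    rw [hh]
    field_simp
    ring
  simp only [key]
  have hsum : ∑ i, x i ^ 2 = ‖x‖ ^ 2 := by rw [hsq, Fin.sum_univ_three]
  -- Only the summation indices are exchanged; no symmetry of the second derivatives is used.
  have hswap : ∑ i, ∑ j, x i * x j * pd i (G j) x = ∑ i, ∑ j, x i * x j * pd j (G i) x := by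
    rw [Finset.sum_comm]
    exact Finset.sum_congr rfl fun i _ => Finset.sum_congr rfl fun j _ => by ring
  rw [← Finset.mul_sum, Finset.sum_sub_distrib, Finset.sum_sub_distrib, Finset.sum_add_distrib,
    ← Finset.mul_sum, ← Finset.mul_sum, ← Finset.mul_sum, hsum, hswap, Finset.sum_const,
    Finset.card_univ, Fintype.card_fin]
  congr 1
  field_simp
  ring

/-- The mean curvature of a regular level set at a point where it is tangent to a sphere centred
at the origin. -/
theorem meanCurvature_of_tangent {α β : ℝ → ℝ} {α' β' lam : ℝ} {F : E3 → ℝ} {x : E3}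
    (hx : x ≠ 0) (hα : ∀ R > 0, 0 < α R) (hγ : ∀ R > 0, 0 < radialCoeff α β R)
    (hα' : HasDerivAt α α' ‖x‖) (hβ' : HasDerivAt β β' ‖x‖)
    (hF : ∀ i, DifferentiableAt ℝ (pd i F) x) (hFx : ∀ i, pd i F x = lam * x i) (hlam : lam ≠ 0) :
    ∃ c > 0, meanCurvature (radialMetric α β) F x = c *
      (((∑ i, pd i (pd i F) x) - (∑ i, ∑ j, x i * x j * pd j (pd i F) x) / ‖x‖ ^ 2 - 2 * lam)
          / α ‖x‖
        + lam * (2 * α ‖x‖ + ‖x‖ * α') / (α ‖x‖ * radialCoeff α β ‖x‖)) := by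
  have hn : 0 < ‖x‖ := norm_pos_iff.2 hx
  have hB : ∀ R, radialCoeff α β R = α R + β R * R ^ 2 := fun _ => rfl
  have hγ' : HasDerivAt (radialCoeff α β) (α' + (β' * ‖x‖ ^ 2 + β ‖x‖ * (2 * ‖x‖))) ‖x‖ := by
    have h : HasDerivAt (radialCoeff α β) _ ‖x‖ := hα'.add (hβ'.mul (hasDerivAt_pow 2 ‖x‖))
    exact h.congr_deriv (by norm_num)
  set γ' := α' + (β' * ‖x‖ ^ 2 + β ‖x‖ * (2 * ‖x‖)) with hγ'_def
  have hα0 := hα _ hn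
  have hγ0 := hγ _ hn
  have ha : HasDerivAt (fun R => (α R)⁻¹) (-α' / α ‖x‖ ^ 2) ‖x‖ := hα'.fun_inv hα0.ne'
  have hκ := hβ'.fun_div (hα'.fun_mul hγ') (mul_pos hα0 hγ0).ne'
  have hJ := hα'.fun_mul (hγ'.sqrt hγ0.ne')
  -- The radial component of the inverse metric.
  have hinv : (α ‖x‖)⁻¹ - β ‖x‖ / (α ‖x‖ * radialCoeff α β ‖x‖) * ‖x‖ ^ 2
      = (radialCoeff α β ‖x‖)⁻¹ := by
    have := hB ‖x‖
    generalize radialCoeff α β ‖x‖ = γ at *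
    field_simp
    linear_combination this
  have key := sum_pd_normal hx ha hκ hJ hF hFx hlam (by rw [hinv]; positivity)
  refine ⟨(√(lam ^ 2 * ‖x‖ ^ 2 * (radialCoeff α β ‖x‖)⁻¹))⁻¹, by positivity, ?_⟩
  have hcongr : ∀ i, (fun y => √(radialMetric α β y).det * levelNormal (radialMetric α β) F y i)
      =ᶠ[𝓝 x] fun y => (α ‖y‖ * √(radialCoeff α β ‖y‖)) *
        (((α ‖y‖)⁻¹ * pd i F y + -(β ‖y‖ / (α ‖y‖ * radialCoeff α β ‖y‖)) *
          (y i * ∑ j, y j * pd j F y)) *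
        (√((α ‖y‖)⁻¹ * ∑ j, pd j F y ^ 2 + -(β ‖y‖ / (α ‖y‖ * radialCoeff α β ‖y‖)) *
          (∑ j, y j * pd j F y) ^ 2))⁻¹) := by
    intro i
    filter_upwards [isOpen_ne.mem_nhds hx] with y hy
    have hyn : 0 < ‖y‖ := norm_pos_iff.2 hy
    simp only [levelNormal, unitDual]
    rw [sum_radialMetric_inv_mul (hα _ hyn).ne' (hγ _ hyn).ne',
      covectorNormSq_radialMetric (hα _ hyn).ne' (hγ _ hyn).ne', radialMetric_det,
      Real.sqrt_mul (by positivity), Real.sqrt_sq (hα _ hyn).le]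
    simp only [neg_mul, ← sub_eq_add_neg, div_eq_mul_inv]
  rw [meanCurvature, divergence]
  simp only [fun i => pd_congr i (hcongr i)]
  rw [key, hinv, radialMetric_det, Real.sqrt_mul (by positivity), Real.sqrt_sq hα0.le]
  have hs := Real.sq_sqrt hγ0.le
  have hs0 := Real.sqrt_pos.2 hγ0
  generalize (√(lam ^ 2 * ‖x‖ ^ 2 * (radialCoeff α β ‖x‖)⁻¹))⁻¹ = c
  generalize ∑ i, pd i (pd i F) x = tr
  generalize ∑ i, ∑ j, x i * x j * pd j (pd i F) x = pHp
  have hγx := hB ‖x‖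
  generalize √(radialCoeff α β ‖x‖) = s at *
  generalize radialCoeff α β ‖x‖ = γ at *
  have hβx : β ‖x‖ = (γ - α ‖x‖) / ‖x‖ ^ 2 := by field_simp; linarith
  have hβx' : β' = (γ' - α' - 2 * ‖x‖ * β ‖x‖) / ‖x‖ ^ 2 := by field_simp; rw [hγ'_def]; ring
  rw [hβx', hβx, ← hs]
  field_simp
  ring

/-! ### Closed minimal surfaces -/

theorem fderiv_apply_eq_sum (F : E3 → ℝ) (x v : E3) : fderiv ℝ F x v = ∑ i, v i * pd i F x := by
  have hv : v = ∑ i, v i • EuclideanSpace.single i (1 : ℝ) := by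
    ext j
    simp [Fin.sum_univ_three]
    fin_cases j <;> simp
  conv_lhs => rw [hv, map_sum]
  simp [pd]

theorem hasDerivAt_comp_curve {F : E3 → ℝ} {c : ℝ → E3} {c' : E3} {t : ℝ}
    (hF : DifferentiableAt ℝ F (c t)) (hc : HasDerivAt c c' t) :
    HasDerivAt (fun t => F (c t)) (∑ i, c' i * pd i F (c t)) t := by
  rw [← fderiv_apply_eq_sum]
  exact hF.hasFDerivAt.comp_hasDerivAt t hc

theorem differentiableAt_pd {F : E3 → ℝ} {x : E3} (hF : ContDiffAt ℝ 2 F x) (i : Fin 3) :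
    DifferentiableAt ℝ (pd i F) x := by
  have h : ContDiffAt ℝ 1 (fderiv ℝ F) x := hF.fderiv_right (by norm_num)
  exact (h.differentiableAt one_ne_zero).clm_apply (differentiableAt_const _)

/-- A function that increases along the ray through its zero `p` has a zero on each nearby ray. -/
theorem eventually_exists_smul_eq_zero {F : E3 → ℝ} {V : Set E3} {p : E3} (hV : V ∈ 𝓝 p)
    (hc : ContinuousOn F V) (hd : DifferentiableAt ℝ F p) (h0 : F p = 0)
    (hpos : 0 < fderiv ℝ F p p) :
    ∀ᶠ y in 𝓝 p, ∃ s : ℝ, 0 < s ∧ s • y ∈ V ∧ F (s • y) = 0 ∧ (F y < 0 → 1 < s) := by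
  obtain ⟨ε, hε, hball⟩ := Metric.mem_nhds_iff.1 hV
  have hcb : ContinuousOn F (Metric.ball p ε) := hc.mono hball
  have hF : ∀ y ∈ Metric.ball p ε, ContinuousAt F y := fun y hy =>
    hcb.continuousAt (Metric.isOpen_ball.mem_nhds hy)
  have hg : HasDerivAt (fun t : ℝ => F (t • p)) (fderiv ℝ F p p) 1 := by
    have h1 : HasDerivAt (fun t : ℝ => t • p) p 1 := by
      simpa using (hasDerivAt_id (1 : ℝ)).smul_const p
    have h2 : HasFDerivAt F (fderiv ℝ F p) ((1 : ℝ) • p) := by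
      simpa using hd.hasFDerivAt
    exact h2.comp_hasDerivAt 1 h1
  have hsign := eventually_nhdsWithin_sign_eq_of_deriv_pos (f := fun t : ℝ => F (t • p)) (x₀ := 1)
    (by rw [hg.deriv]; exact hpos) (by simpa using h0)
  have hmem : ∀ᶠ t : ℝ in 𝓝 1, t • p ∈ Metric.ball p ε := by
    have : ContinuousAt (fun t : ℝ => t • p) 1 := by fun_prop
    refine this.eventually (p := fun y => y ∈ Metric.ball p ε) ?_
    simp only [one_smul]
    exact Metric.ball_mem_nhds p hε
  have hall := hsign.and (hmem.and (eventually_gt_nhds (zero_lt_one (α := ℝ))))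
  -- Parameters t₀ < 1 < t₁ with F negative at t₀p and positive at t₁p. The signs persist for y near
  -- p, and the intermediate value theorem applies along the ray of y.
  obtain ⟨t₁, ⟨hs1, hm1, -⟩, ht1⟩ :=
    ((hall.filter_mono nhdsWithin_le_nhds).and (self_mem_nhdsWithin : Ioi (1 : ℝ) ∈ 𝓝[>] 1)).exists
  obtain ⟨t₀, ⟨hs0, hm0, hp0⟩, ht0⟩ :=
    ((hall.filter_mono nhdsWithin_le_nhds).and (self_mem_nhdsWithin : Iio (1 : ℝ) ∈ 𝓝[<] 1)).exists
  rw [sign_pos (sub_pos.2 ht1), sign_eq_one_iff] at hs1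
  rw [sign_neg (sub_neg.2 ht0), sign_eq_neg_one_iff] at hs0
  have ev : ∀ t : ℝ, t • p ∈ Metric.ball p ε → Tendsto (fun y : E3 => t • y) (𝓝 p) (𝓝 (t • p)) :=
    fun t _ => (continuous_const_smul t).tendsto p
  filter_upwards [(ev t₁ hm1).eventually (Metric.isOpen_ball.mem_nhds hm1),
    (ev t₀ hm0).eventually (Metric.isOpen_ball.mem_nhds hm0),
    Metric.ball_mem_nhds p hε,
    ((hF _ hm1).tendsto.comp (ev t₁ hm1)).eventually (lt_mem_nhds hs1),
    ((hF _ hm0).tendsto.comp (ev t₀ hm0)).eventually (gt_mem_nhds hs0)] with y h1 h0' hy hF1 hF0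
  have hord : OrdConnected {s : ℝ | s • y ∈ Metric.ball p ε} :=
    ((convex_ball p ε).linear_preimage (LinearMap.toSpanSingleton ℝ E3 y)).ordConnected
  have hy1 : (1 : ℝ) • y ∈ Metric.ball p ε := by simpa using hy
  have hcont : ∀ a b : ℝ, a • y ∈ Metric.ball p ε → b • y ∈ Metric.ball p ε →
      ContinuousOn (fun s : ℝ => F (s • y)) (Icc a b) := fun a b ha hb =>
    hcb.comp (by fun_prop) fun s hs => hord.out ha hb hs
  -- If F(y) < 0, the zero is sought between 1 and t₁, which forces s > 1.
  rcases lt_or_ge (F y) 0 with hneg | hnn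
  · obtain ⟨s, hs, hs'⟩ := intermediate_value_Icc ht1.le (hcont 1 t₁ hy1 h1)
      ⟨by simpa using hneg.le, (show 0 < F (t₁ • y) from hF1).le⟩
    have hs1 : s ≠ 1 := by
      rintro rfl
      simp only [one_smul] at hs'
      linarith
    have : 1 < s := lt_of_le_of_ne hs.1 hs1.symm
    exact ⟨s, by linarith, hball (hord.out hy1 h1 hs), hs', fun _ => this⟩
  · obtain ⟨s, hs, hs'⟩ := intermediate_value_Icc ht0.le (hcont t₀ 1 h0' hy1)
      ⟨(show F (t₀ • y) < 0 from hF0).le, by simpa using hnn⟩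
    exact ⟨s, by linarith [hs.1], hball (hord.out h0' hy1 hs), hs', fun h => absurd h hnn.not_gt⟩

/-- At a point of a hypersurface that is farthest from the origin, the gradient is radial. -/
theorem exists_gradient_eq_smul {F : E3 → ℝ} {p : E3} (hp : p ≠ 0) (hF : ContDiffAt ℝ 2 F p)
    (hdF : fderiv ℝ F p ≠ 0) (hmax : ∀ᶠ y in 𝓝 p, F y = F p → ‖y‖ ≤ ‖p‖) :
    ∃ lam : ℝ, lam ≠ 0 ∧ ∀ i, pd i F p = lam * p i := by
  have hext : IsLocalExtrOn (fun y : E3 => ‖y‖ ^ 2) {y | F y = F p} p := by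
    refine Or.inr ?_
    refine eventually_nhdsWithin_iff.2 ?_
    filter_upwards [hmax] with y hy hy'
    exact pow_le_pow_left₀ (norm_nonneg y) (hy hy') 2
  obtain ⟨a, b, hab, h⟩ := hext.exists_multipliers_of_hasStrictFDerivAt_1d
    (hF.hasStrictFDerivAt (by norm_num)) (hasStrictFDerivAt_norm_sq p)
  have hv : ∀ v, a * fderiv ℝ F p v + b * (2 * inner ℝ p v) = 0 := by
    intro v
    have := congrArg (fun L : E3 →L[ℝ] ℝ => L v) h
    simpa using this
  have hn : ‖p‖ ≠ 0 := norm_ne_zero_iff.2 hp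
  have ha : a ≠ 0 := by
    rintro rfl
    have h1 := hv p
    rw [real_inner_self_eq_norm_sq] at h1
    have hb : b = 0 := by
      by_contra hb
      have : b * (2 * ‖p‖ ^ 2) ≠ 0 := by positivity
      apply this
      linarith
    exact hab (by rw [hb]; rfl)
  have hv' : ∀ v, fderiv ℝ F p v = (-2 * b / a) * inner ℝ p v := by
    intro v
    have := hv v
    field_simp
    linarith
  refine ⟨-2 * b / a, ?_, fun i => ?_⟩
  · intro h0
    apply hdF
    ext v
    rw [hv', h0]
    simp
  · rw [pd, hv']
    simp [EuclideanSpace.inner_single_right]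

/-- Second-derivative test along a curve that leaves p with velocity w, agrees to second order with
a great circle, and stays outside the ball of radius |p|, so that lam · F is nonnegative on it. -/
theorem second_order_of_nonneg_exterior {F : E3 → ℝ} {p w : E3} {lam : ℝ} (hp : p ≠ 0)
    (hF : ContDiffAt ℝ 2 F p) (hFp : ∀ i, pd i F p = lam * p i) (h0 : F p = 0)
    (hnn : ∀ᶠ y in 𝓝 p, ‖p‖ ≤ ‖y‖ → 0 ≤ lam * F y) (hw : inner ℝ p w = 0) :
    0 ≤ lam * ((∑ i, ∑ j, w i * w j * pd j (pd i F) p) - lam * ‖w‖ ^ 2) := by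
  have hn : ‖p‖ ≠ 0 := norm_ne_zero_iff.2 hp
  -- This k cancels the t² terms: |c(t)|² = |p|² + (kt²/2)²|p|².
  set k := ‖w‖ ^ 2 / ‖p‖ ^ 2 with hk
  set c : ℝ → E3 := fun t => p + t • w + (-(k / 2) * t ^ 2) • p with hc_def
  have hc : ∀ t, HasDerivAt c (w + (-k * t) • p) t := by
    intro t
    have h1 := ((hasDerivAt_id t).smul_const w).const_add p
    have h2 := ((hasDerivAt_pow 2 t).const_mul (-(k / 2))).smul_const p
    refine (h1.fun_add h2).congr_deriv ?_
    norm_num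
    ring_nf
  have hc0 : c 0 = p := by simp [hc_def]
  have hcc : Tendsto c (𝓝 0) (𝓝 p) := by
    have := (hc 0).continuousAt.tendsto
    rwa [hc0] at this
  have hcn : ∀ t, ‖p‖ ≤ ‖c t‖ := by
    intro t
    have h1 : ‖c t‖ ^ 2 = ‖p‖ ^ 2 + (k / 2 * t ^ 2) ^ 2 * ‖p‖ ^ 2 := by
      have e : c t = (1 - k / 2 * t ^ 2) • p + t • w := by
        simp only [hc_def]; module
      rw [e, norm_add_sq_real, inner_smul_left, inner_smul_right, hw, norm_smul, norm_smul,
        mul_pow, mul_pow, Real.norm_eq_abs, Real.norm_eq_abs, sq_abs, sq_abs]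
      have hw2 : ‖w‖ ^ 2 = k * ‖p‖ ^ 2 := by rw [hk]; field_simp
      rw [hw2]
      simp
      ring
    refine (pow_le_pow_iff_left₀ (norm_nonneg _) (norm_nonneg _) two_ne_zero).1 ?_
    rw [h1]
    exact le_add_of_nonneg_right (by positivity)
  set f : ℝ → ℝ := fun t => lam * F (c t) with hf
  have hfnn : ∀ᶠ t in 𝓝 0, 0 ≤ f t := by
    filter_upwards [hcc.eventually hnn] with t ht using ht (hcn t)
  have hd : ∀ᶠ y in 𝓝 p, DifferentiableAt ℝ F y := by
    filter_upwards [hF.eventually (by simp)] with y hy using hy.differentiableAt (by norm_num)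
  have hf' : ∀ᶠ t in 𝓝 0, HasDerivAt f (lam * ∑ i, (w + (-k * t) • p) i * pd i F (c t)) t := by
    filter_upwards [hcc.eventually hd] with t ht
    exact (hasDerivAt_comp_curve ht (hc t)).const_mul lam
  have hinner : ∑ i, p i * w i = 0 := by
    simpa [PiLp.inner_apply, mul_comm] using hw
  have hpp : ∑ i, p i * p i = ‖p‖ ^ 2 := by
    rw [norm_sq_eq_sum, Fin.sum_univ_three]; ring
  have hf0' : deriv f 0 = 0 := by
    rw [hf'.self_of_nhds.deriv, hc0]
    simp only [hFp]
    have : ∑ i, (w + (-k * 0) • p) i * (lam * p i) = lam * ∑ i, p i * w i := by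
      rw [Finset.mul_sum]
      exact Finset.sum_congr rfl fun i _ => by simp; ring
    rw [this, hinner]
    simp
  have hderiv : deriv f =ᶠ[𝓝 0] fun t => lam * ∑ i, (w i + (-k * t) * p i) * pd i F (c t) := by
    filter_upwards [hf'] with t ht
    rw [ht.deriv]
    simp
  have hf'' : deriv (deriv f) 0
      = lam * ((∑ i, ∑ j, w i * w j * pd j (pd i F) p) - lam * ‖w‖ ^ 2) := by
    rw [hderiv.deriv_eq]
    have h1 : ∀ i, HasDerivAt (fun t => (w i + (-k * t) * p i) * pd i F (c t))
        (-k * p i * (lam * p i) + w i * ∑ j, w j * pd j (pd i F) p) 0 := by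
      intro i
      have h2 : HasDerivAt (fun t => w i + (-k * t) * p i) (-k * p i) 0 := by
        simpa using (((hasDerivAt_id (0 : ℝ)).const_mul (-k)).mul_const (p i)).const_add (w i)
      have h3 := hasDerivAt_comp_curve (F := pd i F) (by rw [hc0]; exact differentiableAt_pd hF i)
        (hc 0)
      refine (h2.fun_mul h3).congr_deriv ?_
      rw [hc0, hFp]
      simp
    rw [((HasDerivAt.fun_sum fun i _ => h1 i).const_mul lam).deriv, Finset.sum_add_distrib]
    have e1 : ∑ i, -k * p i * (lam * p i) = -(k * ‖p‖ ^ 2) * lam := by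
      rw [← hpp, Finset.mul_sum, ← Finset.sum_neg_distrib, Finset.sum_mul]
      exact Finset.sum_congr rfl fun i _ => by ring
    have e2 : k * ‖p‖ ^ 2 = ‖w‖ ^ 2 := by rw [hk]; field_simp
    rw [e1, e2]
    simp only [Finset.mul_sum, mul_assoc]
    ring
  rw [← hf'']
  by_contra! hlt
  -- A negative second derivative would make 0 a local maximum; being nonnegative, f would then
  -- vanish identically near 0, a contradiction.
  have hmax := isLocalMax_of_deriv_deriv_neg hlt hf0' hf'.self_of_nhds.continuousAt
  have hf00 : f 0 = 0 := by simp [hf, hc0, h0]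
  have hzero : f =ᶠ[𝓝 0] fun _ => 0 := by
    filter_upwards [hmax, hfnn] with t h1 h2
    rw [hf00] at h1
    exact le_antisymm h1 h2
  have : deriv (deriv f) 0 = 0 := by
    rw [hzero.deriv.deriv_eq]
    simp
  linarith

/-- The tangential trace is taken without an orthonormal frame: the vectors W k are |p|² times the
tangential projections Π of the basis vectors, so Σ W⊗W = |p|⁴ Π and Σ|W|² = 2|p|⁴. -/
theorem trace_hessian_of_nonneg_exterior {F : E3 → ℝ} {p : E3} {lam : ℝ} (hp : p ≠ 0)
    (hF : ContDiffAt ℝ 2 F p) (hFp : ∀ i, pd i F p = lam * p i) (h0 : F p = 0)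
    (hnn : ∀ᶠ y in 𝓝 p, ‖p‖ ≤ ‖y‖ → 0 ≤ lam * F y) :
    0 ≤ lam * ((∑ i, pd i (pd i F) p)
      - (∑ i, ∑ j, p i * p j * pd j (pd i F) p) / ‖p‖ ^ 2 - 2 * lam) := by
  have hn : 0 < ‖p‖ := norm_pos_iff.2 hp
  have hsq := norm_sq_eq_sum p
  set W : Fin 3 → E3 := fun k => ‖p‖ ^ 2 • EuclideanSpace.single k 1 - p k • p with hW
  have hk : ∀ k, 0 ≤ lam * ((∑ i, ∑ j, W k i * W k j * pd j (pd i F) p) - lam * ‖W k‖ ^ 2) := by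
    intro k
    refine second_order_of_nonneg_exterior hp hF hFp h0 hnn ?_
    rw [hW, inner_sub_right, inner_smul_right, inner_smul_right, real_inner_self_eq_norm_sq]
    simp [EuclideanSpace.inner_single_right]
    ring
  have hsum := Finset.sum_nonneg fun k (_ : k ∈ Finset.univ) => hk k
  have e : ∑ k, lam * ((∑ i, ∑ j, W k i * W k j * pd j (pd i F) p) - lam * ‖W k‖ ^ 2)
      = ‖p‖ ^ 4 * (lam * ((∑ i, pd i (pd i F) p)
      - (∑ i, ∑ j, p i * p j * pd j (pd i F) p) / ‖p‖ ^ 2 - 2 * lam)) := by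
    have e1 : ‖p‖ ^ 4 * (lam * ((∑ i, pd i (pd i F) p)
      - (∑ i, ∑ j, p i * p j * pd j (pd i F) p) / ‖p‖ ^ 2 - 2 * lam))
      = lam * ((‖p‖ ^ 2) ^ 2 * (∑ i, pd i (pd i F) p) - ‖p‖ ^ 2 *
        (∑ i, ∑ j, p i * p j * pd j (pd i F) p) - (‖p‖ ^ 2) ^ 2 * (2 * lam)) := by
      field_simp
    rw [e1]
    simp only [norm_sq_eq_sum (W _)]
    simp only [hW, hsq, Fin.sum_univ_three]
    simp
    ring
  rw [e] at hsum
  exact nonneg_of_mul_nonneg_right hsum (by positivity)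

/-- A closed minimal surface outside the unit ball is the unit sphere, if the spheres of radius
greater than one have positive mean curvature. -/
theorem eq_sphere_of_isClosedMinimalSurface {α β α' β' : ℝ → ℝ} (hα : ∀ R > 0, 0 < α R)
    (hγ : ∀ R > 0, 0 < radialCoeff α β R) (hα' : ∀ R > 0, HasDerivAt α (α' R) R)
    (hβ' : ∀ R > 0, HasDerivAt β (β' R) R) (hconv : ∀ R > 1, 0 < 2 * α R + R * α' R) {S : Set E3}
    (hS1 : ∀ x ∈ S, 1 ≤ ‖x‖) (hS : IsClosedMinimalSurface (radialMetric α β) S) :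
    S = {x | ‖x‖ = 1} := by
  obtain ⟨hcomp, hne, hloc⟩ := hS
  obtain ⟨q, hqS, hq⟩ := hcomp.exists_isMaxOn hne continuous_norm.continuousOn
  have hqmax : ∀ y ∈ S, ‖y‖ ≤ ‖q‖ := fun y hy => hq hy
  -- This is used twice: at a farthest point, and at every point of S once S is known to lie on the
  -- unit sphere.
  have hmain : ∀ p ∈ S, (∀ y ∈ S, ‖y‖ ≤ ‖p‖) → ∃ (V : Set E3) (F : E3 → ℝ) (lam : ℝ), IsOpen V ∧
      p ∈ V ∧ ContDiffOn ℝ 2 F V ∧ lam ≠ 0 ∧ (∀ i, pd i F p = lam * p i) ∧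
      S ∩ V = {x ∈ V | F x = 0} ∧ meanCurvature (radialMetric α β) F p = 0 ∧
      ∀ᶠ y in 𝓝 p, ∃ s : ℝ, 0 < s ∧ s • y ∈ V ∧ F (s • y) = 0 ∧ (lam * F y < 0 → 1 < s) := by
    intro p hpS hmax
    obtain ⟨V, F, hVo, hpV, hF, hdF, hSV, hH⟩ := hloc p hpS
    have hp : p ≠ 0 := norm_pos_iff.1 (one_pos.trans_le (hS1 p hpS))
    have hVp : V ∈ 𝓝 p := hVo.mem_nhds hpV
    have hFp := hF.contDiffAt hVp
    have hF0 : F p = 0 := (hSV.subset ⟨hpS, hpV⟩).2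
    obtain ⟨lam, hlam, hgrad⟩ := exists_gradient_eq_smul hp hFp (hdF p hpV) (by
      filter_upwards [hVp] with y hy hFy
      exact hmax y (hSV.superset ⟨hy, hFy.trans hF0⟩).1)
    have hd : DifferentiableAt ℝ F p := hFp.differentiableAt (by norm_num)
    refine ⟨V, F, lam, hVo, hpV, hF, hlam, hgrad, hSV, hH p ⟨hpS, hpV⟩, ?_⟩
    have h1 := eventually_exists_smul_eq_zero (F := fun y => lam * F y) hVp
      (continuousOn_const.mul hF.continuousOn) (hd.const_mul lam) (by simp [hF0]) (by
        rw [fderiv_const_mul hd, FunLike.coe_smul, Pi.smul_apply, fderiv_apply_eq_sum, smul_eq_mul]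
        have e : ∑ i, p i * pd i F p = lam * ‖p‖ ^ 2 := by
          simp only [hgrad, norm_sq_eq_sum, Fin.sum_univ_three]; ring
        have hn : 0 < ‖p‖ := norm_pos_iff.2 hp
        rw [e, ← mul_assoc, ← pow_two]
        positivity)
    filter_upwards [h1] with y ⟨s, hs, hsV, hs0, hs1⟩
    exact ⟨s, hs, hsV, (mul_eq_zero.1 hs0).resolve_left hlam, hs1⟩
  have hq1 : ‖q‖ ≤ 1 := by
    by_contra! hgt
    obtain ⟨V, F, lam, hVo, hqV, hF, hlam, hgrad, hSV, hH, hev⟩ := hmain q hqS hqmax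
    have hn : 0 < ‖q‖ := one_pos.trans hgt
    have hq0 : q ≠ 0 := norm_pos_iff.1 hn
    have hFq := hF.contDiffAt (hVo.mem_nhds hqV)
    have hF0 : F q = 0 := (hSV.subset ⟨hqS, hqV⟩).2
    have htr := trace_hessian_of_nonneg_exterior hq0 hFq hgrad hF0 (by
      have hy0 : ∀ᶠ y in 𝓝 q, y ≠ 0 := isOpen_ne.mem_nhds hq0
      filter_upwards [hev, hy0] with y ⟨s, hs, hsV, hs0, hs1⟩ hy0 hqy
      by_contra! hneg
      -- If lam · F(y) < 0 with |y| ≥ |q|, the surface contains s • y with s > 1, farther out than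
      -- q.
      have h1 := hqmax _ (hSV.superset ⟨hsV, hs0⟩).1
      rw [norm_smul, Real.norm_of_nonneg hs.le] at h1
      nlinarith [hs1 hneg, norm_pos_iff.2 hy0])
    obtain ⟨c, hc, hmc⟩ := meanCurvature_of_tangent hq0 hα hγ (hα' _ hn) (hβ' _ hn)
      (differentiableAt_pd hFq) hgrad hlam
    rw [hH] at hmc
    have hz := (mul_eq_zero.1 hmc.symm).resolve_left hc.ne'
    have hα0 := hα _ hn
    have hγ0 := hγ _ hn
    generalize (∑ i, pd i (pd i F) q) - (∑ i, ∑ j, q i * q j * pd j (pd i F) q) / ‖q‖ ^ 2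
      - 2 * lam = X at htr hz
    have h1 := div_nonneg htr hα0.le
    have h2 : 0 < lam ^ 2 * (2 * α ‖q‖ + ‖q‖ * α' ‖q‖) / (α ‖q‖ * radialCoeff α β ‖q‖) := by
      have := hconv _ hgt
      positivity
    -- Multiplied by lam, the vanishing mean curvature is a nonnegative Hessian term plus a positive
    -- term from the sphere.
    have h3 : lam * X / α ‖q‖
        + lam ^ 2 * (2 * α ‖q‖ + ‖q‖ * α' ‖q‖) / (α ‖q‖ * radialCoeff α β ‖q‖) = 0 := by
      linear_combination lam * hz
    linarith
  have hsub : ∀ x ∈ S, ‖x‖ = 1 := fun x hx => le_antisymm ((hqmax x hx).trans hq1) (hS1 x hx)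
  refine Subset.antisymm hsub ?_
  -- S meets every ray near p, and on the unit sphere this forces s = 1. So S is open in the sphere,
  -- closed and nonempty, hence everything by connectedness.
  have hopen : ∀ p ∈ S, p ∈ interior {y : E3 | ‖y‖ = 1 → y ∈ S} := by
    intro p hpS
    obtain ⟨V, F, lam, hVo, hpV, hF, hlam, hgrad, hSV, hH, hev⟩ :=
      hmain p hpS fun y hy => by rw [hsub y hy, hsub p hpS]
    refine mem_interior_iff_mem_nhds.2 ?_
    filter_upwards [hev] with y ⟨s, hs, hsV, hs0, _⟩ hy
    have h1 := (hSV.superset ⟨hsV, hs0⟩).1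
    have h2 := hsub _ h1
    rw [norm_smul, hy, mul_one, Real.norm_of_nonneg hs.le] at h2
    rwa [h2, one_smul] at h1
  have hconn : IsPreconnected {x : E3 | ‖x‖ = 1} := by
    have hrank : 1 < Module.rank ℝ E3 := by
      rw [← Module.finrank_eq_rank, finrank_euclideanSpace_fin]
      norm_num
    have hsph : {x : E3 | ‖x‖ = 1} = Metric.sphere 0 1 := by ext x; simp
    rw [hsph]
    exact isPreconnected_sphere hrank 0 1
  rcases isPreconnected_iff_subset_of_disjoint.1 hconn _ _ isOpen_interior
    hcomp.isClosed.isOpen_compl (fun y _ => by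
      by_cases h : y ∈ S
      · exact Or.inl (hopen y h)
      · exact Or.inr h) (by
      ext y
      simp only [mem_inter_iff, mem_empty_iff_false, iff_false]
      rintro ⟨h1, h2, h3⟩
      exact h3 (interior_subset h2 h1)) with h | h
  · exact fun y hy => interior_subset (h hy) hy
  · exact absurd hqS (h (hsub q hqS))

/-- For F = (|x|² - 1)/2 the Hessian is the identity and lam = 1, so the Hessian term is 3 - 1 - 2 =
0. What remains is 2α + α', the derivative of R²α at 1. -/
theorem isClosedMinimalSurface_sphere {α β : ℝ → ℝ} {α' β' : ℝ} (hα : ∀ R > 0, 0 < α R)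
    (hγ : ∀ R > 0, 0 < radialCoeff α β R) (hα' : HasDerivAt α α' 1) (hβ' : HasDerivAt β β' 1)
    (hmin : 2 * α 1 + α' = 0) :
    IsClosedMinimalSurface (radialMetric α β) {x | ‖x‖ = 1} := by
  have hsph : {x : E3 | ‖x‖ = 1} = Metric.sphere 0 1 := by ext x; simp
  refine ⟨hsph ▸ isCompact_sphere 0 1, ⟨EuclideanSpace.single 0 1, by simp⟩, fun p hp => ?_⟩
  have hd : ∀ x : E3, HasFDerivAt (fun y : E3 => (1 / 2) * (‖y‖ ^ 2 - 1)) (innerSL ℝ x) x := by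
    intro x
    have h := ((hasStrictFDerivAt_norm_sq x).hasFDerivAt.sub_const 1).const_mul (1 / 2)
    rw [← Nat.cast_smul_eq_nsmul ℝ, smul_smul] at h
    norm_num at h
    simpa using h
  have hpd : ∀ i, pd i (fun y : E3 => (1 / 2) * (‖y‖ ^ 2 - 1)) = fun x => x i := by
    intro i
    ext x
    rw [pd, (hd x).fderiv]
    simp [EuclideanSpace.inner_single_right]
  refine ⟨{0}ᶜ, fun y => (1 / 2) * (‖y‖ ^ 2 - 1), isOpen_compl_singleton, ?_, ?_, ?_, ?_, ?_⟩
  · rintro rfl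
    simp at hp
  · exact (contDiff_const.mul ((contDiff_norm_sq ℝ).sub contDiff_const)).contDiffOn
  · intro x hx h0
    rw [(hd x).fderiv] at h0
    apply hx
    have := congrArg (fun L : E3 →L[ℝ] ℝ => L x) h0
    simpa using this
  · ext x
    simp only [mem_inter_iff, mem_ofPred_eq, mem_compl_iff, mem_singleton_iff]
    constructor
    · rintro ⟨h1, h2⟩
      exact ⟨h2, by rw [h1]; norm_num⟩
    · rintro ⟨h1, h2⟩
      refine ⟨?_, h1⟩
      have : ‖x‖ ^ 2 = 1 := by linarith
      nlinarith [norm_nonneg x]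
  · rintro x ⟨hx1, hx⟩
    have hx1 : ‖x‖ = 1 := hx1
    obtain ⟨c, -, hmc⟩ := meanCurvature_of_tangent (F := fun y : E3 => (1 / 2) * (‖y‖ ^ 2 - 1))
      (lam := 1) hx hα hγ (by rw [hx1]; exact hα') (by rw [hx1]; exact hβ')
      (fun i => by rw [hpd]; exact differentiableAt_coord i x) (fun i => by rw [hpd, one_mul])
      one_ne_zero
    rw [hmc, hx1]
    have e := norm_sq_eq_sum x
    rw [hx1] at e
    simp only [hpd, pd_coord, kron, Fin.sum_univ_three]
    have : (2 * α 1 + 1 * α') = 0 := by rw [one_mul]; exact hmin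
    rw [this]
    simp
    right; left
    linarith

/-! ### The example -/

theorem contDiffOn_comp_norm {φ : ℝ → ℝ} (h : ContDiffOn ℝ ∞ φ (Ioi 0)) :
    ContDiffOn ℝ ∞ (fun x : E3 => φ ‖x‖) {0}ᶜ :=
  h.comp (fun _ hx => (contDiffAt_norm ℝ hx).contDiffWithinAt) fun _ hx => norm_pos_iff.2 hx

theorem contDiff_coord (i : Fin 3) : ContDiff ℝ ∞ fun x : E3 => x i :=
  (EuclideanSpace.proj i : E3 →L[ℝ] ℝ).contDiff

theorem contDiff_quartic : ContDiff ℝ ∞ quartic := by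
  unfold quartic
  fun_prop

theorem contDiffOn_coeffα : ContDiffOn ℝ ∞ coeffα (Ioi 0) := by
  unfold coeffα
  refine .div (by fun_prop) (by fun_prop) fun R hR => ?_
  have : 0 < R := hR
  positivity

theorem contDiffOn_coeffβ : ContDiffOn ℝ ∞ coeffβ (Ioi 0) := by
  have := contDiff_quartic.contDiffOn (s := Ioi 0)
  unfold coeffβ
  refine .div (by fun_prop) (by fun_prop) fun R hR => ?_
  have : 0 < R := hR
  have := quartic_pos this
  positivity

theorem contDiffOn_coeffE_div : ContDiffOn ℝ ∞ (fun R => coeffE R / R) (Ioi 0) := by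
  unfold coeffE
  refine .div (.div (by fun_prop) (by fun_prop) fun R hR => ?_) (by fun_prop) fun R hR => ?_ <;>
  · have : 0 < R := hR
    positivity

/-- The initial data set of the example. -/
def exampleData : InitialData where
  a := 1
  a_pos := one_pos
  g := exampleMetric
  E := exampleField
  B := fun _ => 0
  smooth := by
    refine ⟨{0}ᶜ, isOpen_compl_singleton, fun x hx => ?_, fun i j => ?_, ?_, contDiffOn_const⟩
    · have : 1 ≤ ‖x‖ := hx
      exact norm_pos_iff.1 (one_pos.trans_le this)
    · exact ((contDiffOn_comp_norm contDiffOn_coeffα).mul contDiffOn_const).add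
        ((contDiffOn_comp_norm contDiffOn_coeffβ).mul
          ((contDiff_coord i).mul (contDiff_coord j)).contDiffOn)
    · exact (contDiffOn_comp_norm contDiffOn_coeffE_div).smul contDiff_id.contDiffOn
  posDef := fun x hx => radialMetric_posDef (coeffα_pos (one_pos.trans_le hx))
    (radialCoeff_example_pos (one_pos.trans_le hx))

/-- The mass function of the example in terms of the area radius. -/
def massFunction (r : ℝ) : ℝ := 9 / 4 - 2 / r + 4 / r ^ 2

/-- The radial component of the electric field in terms of the area radius. -/
def fieldFunction (r : ℝ) : ℝ := 2 / r ^ 2 * (1 - 4 / r) ^ 2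

theorem exampleData_pos {x : E3} (hx : x ∈ exampleData.M) : 0 < ‖x‖ := by
  have : 1 ≤ ‖x‖ := hx
  linarith

theorem exampleData_sphericallySymmetric : exampleData.SphericallySymmetric := by
  refine fun Q x hx => ⟨fun v w => ?_, ?_, ?_⟩
  · simp only [exampleData, exampleMetric, metricInner_radialMetric, Q.inner_map_map, Q.norm_map]
  · simp [exampleData, exampleField, Q.norm_map]
  · simp [exampleData]

theorem exampleData_stronglyAsymptoticallyFlat : exampleData.StronglyAsymptoticallyFlat :=
  ⟨fun i j => (decays_example_metric i j).decaysTwice,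
    fun i => (decays_example_field i).decaysTwice, fun _ => Decays.zero.decaysTwice,
    isBigO_example_scalarCurvature⟩

theorem exampleData_chargedDEC : exampleData.ChargedDEC := by
  intro x hx
  have hn := exampleData_pos hx
  have hx0 := norm_pos_iff.1 hn
  have hq := quartic_pos hn
  have h1 : metricInner exampleMetric x (exampleField x) (exampleField x)
      = coeffE ‖x‖ ^ 2 * radialCoeff coeffα coeffβ ‖x‖ := by
    rw [exampleMetric, metricInner_radialMetric, exampleField, radialCoeff]
    simp only [inner_smul_left, inner_smul_right, real_inner_self_eq_norm_sq, conj_trivial]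
    field_simp
  have h2 : metricInner exampleMetric x 0 0 = 0 := by simp [metricInner]
  simp only [exampleData]
  rw [h1, h2, add_zero, scalarCurvature_example hx0, radialCoeff_example hn, coeffE]
  have hx1 : 1 ≤ ‖x‖ := hx
  generalize ‖x‖ = R at *
  -- The scalar curvature is split off; the remaining quotient is (1 - 4/r)²/(1 - 1/(2r) + 2/r²).
  have e : 2 * ((2 * R ^ 4 * (R - 1) ^ 3 / (R + 1) ^ 9) ^ 2
      * (2 * (R + 1) ^ 8 / (R ^ 4 * quartic R)))
      = 8 * R ^ 4 * (R - 1) ^ 2 / (R + 1) ^ 10 * (2 * (R - 1) ^ 4 / quartic R) := by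
    field_simp
    ring
  rw [e]
  refine mul_le_of_le_one_right (by positivity) ?_
  rw [div_le_one hq]
  have : 0 < 15 * R ^ 3 + 2 * R ^ 2 + 15 * R := by positivity
  unfold quartic
  linear_combination this

theorem exampleData_outermostMinimalBoundary : exampleData.OutermostMinimalBoundary := by
  refine ⟨?_, fun S hS hmin => ?_⟩
  · exact isClosedMinimalSurface_sphere (fun R hR => coeffα_pos hR)
      (fun R hR => radialCoeff_example_pos hR) (hasDerivAt_coeffα one_pos)
      (hasDerivAt_coeffβ one_pos) (by norm_num [coeffα])
  · refine eq_sphere_of_isClosedMinimalSurface (fun R hR => coeffα_pos hR)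
      (fun R hR => radialCoeff_example_pos hR) (fun R hR => hasDerivAt_coeffα hR)
      (fun R hR => hasDerivAt_coeffβ hR) (fun R hR => ?_) hS hmin
    have hR0 : 0 < R := one_pos.trans hR
    -- This is (R²α)'/R, where R²α is the square of the area radius; it has the sign of R - 1.
    have e : 2 * coeffα R + R * (-4 * (R + 1) ^ 3 / R ^ 5)
        = 2 * (R + 1) ^ 3 * (R - 1) / R ^ 4 := by
      unfold coeffα
      field_simp
      ring
    have : 0 < R - 1 := sub_pos.2 hR
    rw [e]
    positivity

theorem exampleData_hasTotalCharge : exampleData.HasTotalCharge 2 := by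
  refine ⟨2, 0, ?_, ?_, ?_⟩
  · refine tendsto_exampleCharge.congr' ?_
    filter_upwards [eventually_gt_atTop 0] with R hR using (sphereCharge_example hR).symm
  · refine tendsto_const_nhds.congr' ?_
    filter_upwards [eventually_gt_atTop 0] with R hR
    rw [sphereCharge, sphereIntegral_of_forall (c := 0) hR]
    · simp
    · intro x _
      simp [exampleData, metricInner]
  · rw [show (2 : ℝ) ^ 2 + 0 ^ 2 = 2 ^ 2 by norm_num, Real.sqrt_sq two_pos.le]

theorem exampleData_divCompactlySupported_B : exampleData.DivCompactlySupported exampleData.B :=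
  ⟨∅, isCompact_empty, fun x _ _ => by simp [exampleData, divergence, pd_const]⟩

theorem exampleData_not_divCompactlySupported_E :
    ¬ exampleData.DivCompactlySupported exampleData.E := by
  rintro ⟨K, hK, h⟩
  obtain ⟨r, hr⟩ := hK.isBounded.subset_closedBall (0 : E3)
  obtain ⟨x, hx, hne⟩ := exists_divergence_exampleField_ne_zero (max r 1)
  refine hne (h x ((le_max_right r 1).trans hx.le) fun hxK => ?_)
  have := hr hxK
  rw [mem_closedBall_zero_iff] at this
  exact absurd ((le_max_left r 1).trans_lt hx) this.not_gt

/-- The derivative vanishes at R = 1, so r is a coordinate only in the interior. -/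
theorem hasDerivAt_areaRadius {R : ℝ} (hR : 0 < R) :
    HasDerivAt (fun R : ℝ => (R + 1) ^ 2 / R) ((R - 1) * (R + 1) / R ^ 2) R := by
  have h := (((hasDerivAt_id R).add_const 1).fun_pow 2).fun_div (hasDerivAt_id R) hR.ne'
  refine h.congr_deriv ?_
  simp only [id]
  field_simp
  push_cast
  ring

theorem exampleData_arealForm : exampleData.ArealForm 4 massFunction fieldFunction := by
  have hpos : ∀ R > exampleData.a, 0 < R := fun R hR => one_pos.trans hR
  refine ⟨fun R => (R + 1) ^ 2 / R, ?_, ?_, ?_, fun R hR => ?_, ?_, fun x hx => ?_⟩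
  · norm_num [exampleData]
  · refine .div (by fun_prop) (by fun_prop) fun R hR => ?_
    exact (one_pos.trans_le hR : (0 : ℝ) < R).ne'
  · exact .div (by fun_prop) (by fun_prop) fun R hR => (hpos R hR).ne'
  · have hR0 := hpos R hR
    have : 0 < R - 1 := sub_pos.2 hR
    rw [(hasDerivAt_areaRadius hR0).deriv]
    positivity
  · refine tendsto_atTop_mono' _ ?_ tendsto_id
    filter_upwards [eventually_gt_atTop 0] with R hR
    rw [id, le_div_iff₀ hR]
    nlinarith
  · have hn := hpos _ hx
    have hx1 : 0 < ‖x‖ - 1 := sub_pos.2 hx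
    have hq := quartic_pos hn
    simp only [(hasDerivAt_areaRadius hn).deriv]
    refine ⟨fun i j => ?_, fun i => ?_⟩
    · have e : 1 - 2 * massFunction ((‖x‖ + 1) ^ 2 / ‖x‖) / ((‖x‖ + 1) ^ 2 / ‖x‖)
          = (‖x‖ - 1) ^ 2 * quartic ‖x‖ / (2 * (‖x‖ + 1) ^ 6) := by
        unfold massFunction quartic
        field_simp
        ring
      rw [e]
      simp only [exampleData, exampleMetric, radialMetric, coeffα, coeffβ, radial, Matrix.one_apply,
        kron]
      generalize (if i = j then (1 : ℝ) else 0) = δ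
      generalize ‖x‖ = R at *
      field_simp
      unfold quartic
      ring
    · have h := exampleField_apply x i
      simp only [exampleData]
      rw [h, coeffE, fieldFunction]
      generalize ‖x‖ = R at *
      field_simp
      ring

/-! ### Monotonicity of the charged Hawking mass -/

theorem hasDerivAt_massFunction {r : ℝ} (hr : 0 < r) :
    HasDerivAt massFunction (2 / r ^ 2 - 8 / r ^ 3) r := by
  have h := (((hasDerivAt_id r).fun_inv hr.ne').const_mul 2).const_sub (9 / 4) |>.add
    (((hasDerivAt_pow 2 r).fun_inv (by positivity)).const_mul 4)
  refine (h.congr_deriv ?_).congr_of_eventuallyEq (.of_forall fun y => ?_)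
  · simp only [id]
    field_simp
    push_cast
    ring
  · simp [massFunction, div_eq_mul_inv]

theorem strictAntiOn_chargedHawkingMass :
    StrictAntiOn (fun r => massFunction r + 2 ^ 2 / (2 * r)) (Ici 4) := by
  intro r hr s hs hrs
  have hr0 : 0 < r := four_pos.trans_le hr
  have hs0 : 0 < s := four_pos.trans_le hs
  -- With q = 2 the charge term 2/t cancels the -2/t of the mass function.
  have e : ∀ t : ℝ, 0 < t → massFunction t + 2 ^ 2 / (2 * t) = 9 / 4 + 4 / t ^ 2 := by
    intro t ht
    unfold massFunction
    field_simp
    ring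
  simp only [e r hr0, e s hs0]
  gcongr

end ChargedData

end

theorem theorem4 :
    ∃ (D : ChargedData.InitialData) (ρ m q : ℝ) (μ f : ℝ → ℝ),
      -- the data set is spherically symmetric, with vanishing magnetic field
      D.SphericallySymmetric ∧ (∀ x ∈ D.M, D.B x = 0) ∧
      -- it satisfies all the hypotheses of the charged Penrose inequality with charged matter ...
      D.StronglyAsymptoticallyFlat ∧ D.ChargedDEC ∧ D.OutermostMinimalBoundary ∧
      0 < ρ ∧ ChargedData.sphereArea D.g D.a = 4 * Real.pi * ρ ^ 2 ∧
      D.HasADMMass m ∧ D.HasTotalCharge q ∧ |q| ≤ ρ ∧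
      D.DivCompactlySupported D.B ∧
      -- ... except that `div E` is not compactly supported
      ¬ D.DivCompactlySupported D.E ∧
      -- the inequality is violated (and its right-hand side is meaningful)
      |q| ≤ m ∧ ¬ ρ ≤ m + √(m ^ 2 - q ^ 2) ∧
      -- shape of the example: mass function and electric field in terms of the area radius
      D.ArealForm ρ μ f ∧
      ContinuousOn μ (Set.Ici ρ) ∧ ContDiffOn ℝ (⊤ : ℕ∞) μ (Set.Ioi ρ) ∧
      ContDiffOn ℝ (⊤ : ℕ∞) f (Set.Ioi ρ) ∧
      μ ρ = ρ / 2 ∧ (∀ r > ρ, 2 * μ r < r) ∧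
      StrictAntiOn (fun r => μ r + q ^ 2 / (2 * r)) (Set.Ici ρ) ∧
      (∀ r > ρ, f r ^ 2 < 2 * deriv μ r / r ^ 2 * (1 - 2 * μ r / r)) := by
  refine ⟨ChargedData.exampleData, 4, 9 / 4, 2, ChargedData.massFunction,
    ChargedData.fieldFunction, ChargedData.exampleData_sphericallySymmetric, fun _ _ => rfl,
    ChargedData.exampleData_stronglyAsymptoticallyFlat, ChargedData.exampleData_chargedDEC,
    ChargedData.exampleData_outermostMinimalBoundary, four_pos, ChargedData.sphereArea_example,
    ChargedData.tendsto_admIntegral_example, ChargedData.exampleData_hasTotalCharge, by norm_num,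
    ChargedData.exampleData_divCompactlySupported_B,
    ChargedData.exampleData_not_divCompactlySupported_E, by norm_num, ?_,
    ChargedData.exampleData_arealForm, ?_, ?_, ?_, ?_, fun r hr => ?_,
    ChargedData.strictAntiOn_chargedHawkingMass, fun r hr => ?_⟩
  -- The claim is √(17/16) < 7/4, that is 17 < 49.
  · rw [not_le, ← lt_sub_iff_add_lt', Real.sqrt_lt' (by norm_num)]
    norm_num
  · exact fun r hr => (ChargedData.hasDerivAt_massFunction
      (four_pos.trans_le hr)).continuousAt.continuousWithinAt
  · have h0 : ∀ r ∈ Set.Ioi (4 : ℝ), r ≠ 0 := fun r hr => (four_pos.trans hr).ne'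
    exact (contDiffOn_const.sub (contDiffOn_const.div contDiffOn_id h0)).add
      (contDiffOn_const.div (contDiffOn_id.pow 2) fun r hr => pow_ne_zero 2 (h0 r hr))
  · have h0 : ∀ r ∈ Set.Ioi (4 : ℝ), r ≠ 0 := fun r hr => (four_pos.trans hr).ne'
    exact (contDiffOn_const.div (contDiffOn_id.pow 2) fun r hr => pow_ne_zero 2 (h0 r hr)).mul
      ((contDiffOn_const.sub (contDiffOn_const.div contDiffOn_id h0)).pow 2)
  · norm_num [ChargedData.massFunction]
  · have hr0 : 0 < r := four_pos.trans hr
    have hr4 : 0 < r - 4 := sub_pos.2 hr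
    have e : r - 2 * ChargedData.massFunction r = (r - 4) * (r ^ 2 - r / 2 + 2) / r ^ 2 := by
      unfold ChargedData.massFunction
      field_simp
      ring
    have h1 : 0 < r ^ 2 - r / 2 + 2 := by nlinarith
    have h2 : 0 < (r - 4) * (r ^ 2 - r / 2 + 2) / r ^ 2 := by positivity
    linarith
  · have hr0 : 0 < r := four_pos.trans hr
    have hr4 : 0 < r - 4 := sub_pos.2 hr
    rw [(ChargedData.hasDerivAt_massFunction hr0).deriv]
    -- Both terms contain 4r⁻⁴(1 - 4/r)²; the other factors differ by (30r - 56)/(4r²), positive for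
    -- r > 4.
    have e : 2 * (2 / r ^ 2 - 8 / r ^ 3) / r ^ 2 * (1 - 2 * ChargedData.massFunction r / r)
        - ChargedData.fieldFunction r ^ 2
        = (r - 4) ^ 2 * (30 * r - 56) / r ^ 8 := by
      unfold ChargedData.massFunction ChargedData.fieldFunction
      field_simp
      ring
    have h1 : 0 < (r - 4) ^ 2 * (30 * r - 56) / r ^ 8 := by
      have : 0 < 30 * r - 56 := by linarith
      positivity
    linarith
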